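/- Let $k$ be an algebraically closed field of characteristic $2$. For a homogeneous polynomial $G\in H^0(\mathbb P^2,\mathcal O_{\mathbb P^2}(6))$ of degree $6$ over $k$, let $\pi_G:Y_G\to\mathbb P^2$ be the purely inseparable double cover defined by $W^2=G(X,Y,Z)$, that is, $Y_G=\operatorname{Proj} k[X,Y,Z,W]/(W^2-G)$ with $\deg X=\deg Y=\deg Z=1$ and $\deg W=3$, with the projection induced by $k[X,Y,Z]\subset k[X,Y,Z,W]/(W^2-G)$. Since $\mathcal O_{\mathbb P^2}(6)\cong\mathcal O_{\mathbb P^2}(3)^{\otimes 2}$ has transition functions that are squares and $k$ has characteristic $2$, the differentials of the local functions $G/X^6$, $G/Y^6$, $G/Z^6$ define a global section $dG$ of $\Omega^1_{\mathbb P^2}(6)$; let $Z(dG)\subset\mathbb P^2$ be the closed subscheme defined by $dG=0$. Let $\mathcal U$ be the set of all non-zero homogeneous polynomials $G$ of degree $6$ such that $Y_G$ has exactly $21$ singular points and each of them is an ordinary node (a singularity whose completed local ring is isomorphic to $k[[x,y,z]]/(xy-z^2)$). Let $G,G'\in\mathcal U$. Then the following conditions are equivalent: (i) $Y_G$ and $Y_{G'}$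 are isomorphic as schemes over $\mathbb P^2$; (ii) $Z(dG)=Z(dG')$ as closed subschemes of $\mathbb P^2$; (iii) there exist $c\in k^\times$ and a homogeneous polynomial $H\in H^0(\mathbb P^2,\mathcal O_{\mathbb P^2}(3))$ of degree $3$ such that $G'=cG+H^2$. -/

import Mathlib

open AlgebraicGeometry CategoryTheory CategoryTheory.Limits

namespace PlaneDoubleCover

universe u

section Plane

variable (k : Type u) [Field k]

/-- The homogeneous coordinate ring `k[X₀, X₁, X₂]` of the projective plane. -/
abbrev CoordRing : Type u := MvPolynomial (Fin 3) k

/-- The space `H⁰(ℙ², 𝒪(d))` of homogeneous polynomials of degree `d`. -/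
abbrev Form (d : ℕ) : Submodule k (CoordRing k) := MvPolynomial.homogeneousSubmodule (Fin 3) k d

noncomputable instance formGradedAlgebra : GradedAlgebra (Form k) := MvPolynomial.gradedAlgebra

/-- The projective plane over `k`. -/
noncomputable abbrev P2 : Scheme.{u} := Proj (Form k)

lemma X_mem (i : Fin 3) : (MvPolynomial.X i : CoordRing k) ∈ Form k 1 :=
  MvPolynomial.isHomogeneous_X k i

/-- The coordinate ring of the standard affine chart `{Xᵢ ≠ 0}` of the plane. It is an algebra over
the ring `Form k 0` of constant polynomials. -/
abbrev ChartRing (i : Fin 3) : Type u :=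
  HomogeneousLocalization.Away (Form k) (MvPolynomial.X i : CoordRing k)

/-- The inclusion of the standard affine chart `{Xᵢ ≠ 0}`. -/
noncomputable def chartMap (i : Fin 3) : Spec (.of (ChartRing k i)) ⟶ P2 k :=
  Proj.awayι (Form k) (MvPolynomial.X i) (X_mem k i) Nat.one_pos

end Plane

section ZeroScheme

variable {k : Type u} [Field k]

/-- The ideal of the zero scheme of a section `ω` of a locally free module `M` over `A`: it is
generated by the values at `ω` of the linear forms on `M`. -/
def zeroIdeal {A M : Type*} [CommRing A] [AddCommGroup M] [Module A M] (ω : M) : Ideal A :=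
  LinearMap.range (Module.Dual.eval A M ω)

/-- The regular function `G / Xᵢ⁶` on the chart `{Xᵢ ≠ 0}`. -/
noncomputable def dehomogenize (G : Form k 6) (i : Fin 3) : ChartRing k i :=
  HomogeneousLocalization.Away.mk (Form k) (X_mem k i) 6 G G.2

/-- The closed subscheme `Z(dG)` of the plane, given by its ideal sheaf. In characteristic two the
functions `G / Xᵢ⁶` differ on overlaps of the charts by squares of units, so that the differentials
`d(G / Xᵢ⁶)` define a section `dG` of `Ω¹(6)`. A function lies in the ideal sheaf of `Z(dG)` if and
only if its restriction to each chart lies in the ideal of the zero scheme of `d(G / Xᵢ⁶)`. -/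
noncomputable def zeroSchemeD (G : Form k 6) : (P2 k).IdealSheafData :=
  ⨅ i : Fin 3, (Scheme.IdealSheafData.ofIdealTop
    ((zeroIdeal (A := ChartRing k i)
      (KaehlerDifferential.D (Form k 0) (ChartRing k i) (dehomogenize G i))).comap
        (Scheme.ΓSpecIso (.of (ChartRing k i))).hom.hom)).map (chartMap k i)

end ZeroScheme

section Cover

variable {k : Type u} [Field k] (G : Form k 6)

/-- The ring `k[X₀, X₁, X₂][W] / (W² - G)`. -/
abbrev CoverRing : Type u :=
  AdjoinRoot (Polynomial.X ^ 2 - Polynomial.C (G : CoordRing k))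

/-- The grading of `k[X₀, X₁, X₂][W] / (W² - G)` with `deg Xᵢ = 1` and `deg W = 3`. -/
noncomputable def coverGrading (n : ℕ) : Submodule k (CoverRing G) :=
  Submodule.span k {x | ∃ m j : ℕ, m + 3 * j = n ∧ ∃ a ∈ Form k m,
    x = AdjoinRoot.of _ a * AdjoinRoot.root _ ^ j}

lemma of_mem {m : ℕ} {a : CoordRing k} (ha : a ∈ Form k m) :
    (AdjoinRoot.of _ a : CoverRing G) ∈ coverGrading G m :=
  Submodule.subset_span ⟨m, 0, by simp, a, ha, by simp⟩

lemma root_mem : (AdjoinRoot.root _ : CoverRing G) ∈ coverGrading G 3 :=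
  Submodule.subset_span ⟨0, 1, by simp, 1, MvPolynomial.isHomogeneous_one _ _, by simp⟩

lemma root_sq : (AdjoinRoot.root _ : CoverRing G) ^ 2 = AdjoinRoot.of _ (G : CoordRing k) := by
  have h := AdjoinRoot.eval₂_root (Polynomial.X ^ 2 - Polynomial.C (G : CoordRing k))
  simpa [Polynomial.eval₂_sub, sub_eq_zero] using h

instance coverGradedMonoid : SetLike.GradedMonoid (coverGrading G) where
  one_mem := by
    simpa using of_mem G (MvPolynomial.isHomogeneous_one (Fin 3) k)
  mul_mem := by
    intro i j x y hx hy
    induction hx using Submodule.span_induction with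
    | zero => simp
    | add x x' _ _ h h' => rw [add_mul]; exact add_mem h h'
    | smul c x _ h => rw [smul_mul_assoc]; exact Submodule.smul_mem _ _ h
    | mem x hx =>
      induction hy using Submodule.span_induction with
      | zero => simp
      | add y y' _ _ h h' => rw [mul_add]; exact add_mem h h'
      | smul c y _ h => rw [mul_smul_comm]; exact Submodule.smul_mem _ _ h
      | mem y hy =>
        obtain ⟨m, s, rfl, a, ha, rfl⟩ := hx
        obtain ⟨n, t, rfl, b, hb, rfl⟩ := hy
        refine Submodule.subset_span ⟨m + n, s + t, by ring, a * b, ha.mul hb, ?_⟩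
        rw [map_mul]; ring

/-- The inclusion of the forms of degree `n` into the degree `n` part of the cover ring. -/
noncomputable def formIncl (n : ℕ) : Form k n →ₗ[k] coverGrading G n where
  toFun a := ⟨AdjoinRoot.of _ (a : CoordRing k), of_mem G a.2⟩
  map_add' a b := by ext; simp
  map_smul' c a := by
    ext
    simp [Algebra.smul_def]
    rfl

/-- The splitting of a polynomial in `X₀, X₁, X₂` into graded components of the cover ring. -/
noncomputable def splitPoly : CoordRing k →ₐ[k] DirectSum ℕ fun n => coverGrading G n :=
  (DirectSum.toAlgebra k (fun n => Form k n)
    (fun n => (DirectSum.lof k ℕ (fun n => coverGrading G n) n).comp (formIncl G n))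
    (by
      simp only [LinearMap.comp_apply, DirectSum.lof_eq_of, DirectSum.one_def]
      exact congrArg _ (Subtype.ext (map_one _)))
    (by
      intro i j a b
      simp only [LinearMap.comp_apply, DirectSum.lof_eq_of, DirectSum.of_mul_of]
      exact congrArg _ (Subtype.ext (map_mul _ _ _)))).comp
    (DirectSum.decomposeAlgEquiv (Form k)).toAlgHom

lemma splitPoly_of_mem {m : ℕ} {a : CoordRing k} (ha : a ∈ Form k m) :
    splitPoly G a = DirectSum.of (fun n => coverGrading G n) m
      ⟨AdjoinRoot.of _ a, of_mem G ha⟩ := by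
  have : DirectSum.decompose (Form k) a = DirectSum.of (fun n => Form k n) m ⟨a, ha⟩ :=
    DirectSum.decompose_of_mem _ ha
  simp only [splitPoly, AlgHom.comp_apply]
  change DirectSum.toAlgebra k _ _ _ _ (DirectSum.decompose (Form k) a) = _
  rw [this, ← DirectSum.lof_eq_of k]
  exact DirectSum.toModule_lof _ _ _

/-- The splitting of an element of the cover ring into graded components. -/
noncomputable def splitCover : CoverRing G →ₐ[k] DirectSum ℕ fun n => coverGrading G n :=
  AdjoinRoot.liftAlgHom _ (splitPoly G)
    (DirectSum.of (fun n => coverGrading G n) 3 ⟨AdjoinRoot.root _, root_mem G⟩) (by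
      rw [Polynomial.eval₂_sub, Polynomial.eval₂_pow, Polynomial.eval₂_X, Polynomial.eval₂_C,
        sub_eq_zero]
      erw [splitPoly_of_mem G G.2]
      rw [DirectSum.ofPow]
      refine DirectSum.of_eq_of_gradedMonoid_eq ?_
      refine Sigma.subtype_ext rfl ?_
      exact root_sq G)

lemma splitCover_of (a : CoordRing k) : splitCover G (AdjoinRoot.of _ a) = splitPoly G a := by
  unfold splitCover
  exact AdjoinRoot.liftAlgHom_of _ _ _ _ _

lemma splitCover_root : splitCover G (AdjoinRoot.root _) =
    DirectSum.of (fun n => coverGrading G n) 3 ⟨AdjoinRoot.root _, root_mem G⟩ := by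
  unfold splitCover
  exact AdjoinRoot.liftAlgHom_root _ _ _ _

lemma splitCover_of_mem {n : ℕ} {x : CoverRing G} (hx : x ∈ coverGrading G n) :
    splitCover G x = DirectSum.of (fun n => coverGrading G n) n ⟨x, hx⟩ := by
  induction hx using Submodule.span_induction with
  | zero => rw [map_zero]; exact (map_zero _).symm
  | add x y hx hy h h' =>
    rw [map_add, h, h', ← map_add]
    rfl
  | smul c x hx h =>
    rw [map_smul, h, ← DirectSum.of_smul]
    rfl
  | mem x hx =>
    obtain ⟨m, j, rfl, a, ha, rfl⟩ := hx
    rw [map_mul, map_pow, splitCover_of, splitCover_root, splitPoly_of_mem G ha, DirectSum.ofPow, DirectSum.of_mul_of]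
    refine DirectSum.of_eq_of_gradedMonoid_eq (Sigma.subtype_ext ?_ rfl)
    exact congrArg (m + ·) (mul_comm j 3)

noncomputable instance coverGradedAlgebra : GradedAlgebra (coverGrading G) :=
  GradedAlgebra.ofAlgHom _ (splitCover G)
    (by
      have h1 : (DirectSum.coeAlgHom (coverGrading G)).comp (splitPoly G) =
          AdjoinRoot.ofAlgHom k _ := by
        refine MvPolynomial.algHom_ext fun i => ?_
        rw [AlgHom.comp_apply, splitPoly_of_mem G (X_mem k i), DirectSum.coeAlgHom_of]
        rfl
      refine AlgHom.ext fun x => ?_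
      induction x using AdjoinRoot.induction_on with
      | ih p =>
        induction p using Polynomial.induction_on' with
        | add p q hp hq => rw [map_add, map_add, hp, hq, ← map_add]
        | monomial n a =>
          rw [← Polynomial.C_mul_X_pow_eq_monomial, map_mul, map_pow, AdjoinRoot.mk_C,
            AdjoinRoot.mk_X, map_mul, map_mul, map_pow, map_pow]
          refine congrArg₂ (fun u v => u * v ^ n) ?_ ?_
          · rw [AlgHom.comp_apply, splitCover_of]
            exact DFunLike.congr_fun h1 a
          · rw [AlgHom.comp_apply, splitCover_of_mem G (root_mem G), DirectSum.coeAlgHom_of]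
            rfl)
    (fun _ x => splitCover_of_mem G x.2)

/-- The surface `Y_G`, with equation `W² = G` in the weighted projective space `ℙ(1, 1, 1, 3)`. -/
noncomputable abbrev coverSurface : Scheme.{u} := Proj (coverGrading G)

/-- The inclusion of graded rings `k[X₀, X₁, X₂] → k[X₀, X₁, X₂][W] / (W² - G)`. -/
noncomputable def coordIncl : GradedRingHom (Form k) (coverGrading G) where
  __ := AdjoinRoot.of (Polynomial.X ^ 2 - Polynomial.C (G : CoordRing k))
  map_mem h := of_mem G h

/-- The images of the three coordinates in the cover ring. -/
noncomputable abbrev coverCoord (i : Fin 3) : CoverRing G := coordIncl G (MvPolynomial.X i)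

lemma coverCoord_mem (i : Fin 3) : coverCoord G i ∈ coverGrading G 1 :=
  of_mem G (X_mem k i)

lemma iSup_basicOpen_coverCoord :
    ⨆ i, Proj.basicOpen (coverGrading G) (coverCoord G i) = ⊤ := by
  refine top_le_iff.mp fun x _ => TopologicalSpace.Opens.mem_iSup.mpr ?_
  by_contra! H
  have hX : ∀ i, coverCoord G i ∈ x.asHomogeneousIdeal.toIdeal := by
    intro i
    by_contra h
    exact H i h
  have := x.isPrime
  have hof : ∀ m : ℕ, 0 < m → ∀ a ∈ Form k m,
      (AdjoinRoot.of _ a : CoverRing G) ∈ x.asHomogeneousIdeal.toIdeal := by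
    intro m hm a ha
    have h1 : a ∈ Ideal.span (MvPolynomial.X '' Set.univ : Set (CoordRing k)) := by
      rw [MvPolynomial.mem_ideal_span_X_image]
      intro d hd
      have hdeg : d.degree = m := by
        have := ha (MvPolynomial.mem_support_iff.mp hd)
        rwa [Finsupp.degree_eq_weight_one]
      by_contra! h0
      have : d = 0 := Finsupp.ext fun i => h0 i (Set.mem_univ i)
      rw [this] at hdeg
      simp at hdeg
      omega
    have h2 : Ideal.span (MvPolynomial.X '' Set.univ : Set (CoordRing k)) ≤
        x.asHomogeneousIdeal.toIdeal.comap (AdjoinRoot.of _) := by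
      rw [Ideal.span_le]
      rintro _ ⟨i, _, rfl⟩
      exact hX i
    exact h2 h1
  have hW : (AdjoinRoot.root _ : CoverRing G) ∈ x.asHomogeneousIdeal.toIdeal := by
    refine Ideal.IsPrime.mem_of_pow_mem ‹_› 2 ?_
    rw [root_sq]
    exact hof 6 (by norm_num) _ G.2
  refine x.not_irrelevant_le ((HomogeneousIdeal.toIdeal_irrelevant_le _).mpr fun n hn y hy => ?_)
  induction hy using Submodule.span_induction with
  | zero => exact zero_mem _
  | add y z _ _ h h' => exact add_mem h h'
  | smul c y _ h =>
    rw [Algebra.smul_def]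
    exact Ideal.mul_mem_left _ _ h
  | mem y hy =>
    obtain ⟨m, j, rfl, a, ha, rfl⟩ := hy
    rcases Nat.eq_zero_or_pos j with rfl | hj
    · exact Ideal.mul_mem_right _ _ (hof m (by omega) a ha)
    · exact Ideal.mul_mem_left _ _ (Ideal.pow_mem_of_mem _ hW j hj)

/-- The standard affine cover of `Y_G` by the open subschemes `{Xᵢ ≠ 0}`. -/
noncomputable def coverCharts : (coverSurface G).AffineOpenCover where
  I₀ := Fin 3
  X i := .of (HomogeneousLocalization.Away (coverGrading G) (coverCoord G i))
  f i := Proj.awayι (coverGrading G) (coverCoord G i) (coverCoord_mem G i) Nat.one_pos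
  idx x := (TopologicalSpace.Opens.mem_iSup.mp
    ((iSup_basicOpen_coverCoord G).ge (Set.mem_univ x))).choose
  covers x := by
    change x ∈ (Proj.awayι (coverGrading G) _ _ _).opensRange
    rw [Proj.opensRange_awayι]
    exact (TopologicalSpace.Opens.mem_iSup.mp
      ((iSup_basicOpen_coverCoord G).ge (Set.mem_univ x))).choose_spec

/-- The projection of the chart `{Xᵢ ≠ 0}` of `Y_G` to the plane. -/
noncomputable def chartProj (i : Fin 3) :
    Spec (.of (HomogeneousLocalization.Away (coverGrading G) (coverCoord G i))) ⟶ P2 k :=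
  Spec.map (CommRingCat.ofHom
    (HomogeneousLocalization.Away.map (coordIncl G) (MvPolynomial.X i))) ≫ chartMap k i

lemma awayMap_comp_map (i j : Fin 3) {x : CoordRing k}
    (hx : x = MvPolynomial.X i * MvPolynomial.X j)
    (hx' : coordIncl G x = coverCoord G i * coverCoord G j) :
    (HomogeneousLocalization.awayMap (coverGrading G) (coverCoord_mem G j) hx').comp
      (HomogeneousLocalization.Away.map (coordIncl G) (MvPolynomial.X i)) =
    (HomogeneousLocalization.Away.map (coordIncl G) x).comp
      (HomogeneousLocalization.awayMap (Form k) (X_mem k j) hx) := by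
  subst hx
  refine RingHom.ext fun a => ?_
  obtain ⟨n, a, ha, rfl⟩ := HomogeneousLocalization.Away.mk_surjective (Form k) (X_mem k i) a
  rw [RingHom.comp_apply, RingHom.comp_apply, HomogeneousLocalization.Away.map_mk,
    HomogeneousLocalization.awayMap_mk, HomogeneousLocalization.awayMap_mk,
    HomogeneousLocalization.Away.map_mk]
  ext
  simp

lemma SpecMap_awayMap_chartProj (i j : Fin 3) {x : CoordRing k} (hx2 : x ∈ Form k 2)
    (hx : x = MvPolynomial.X i * MvPolynomial.X j)
    (hx' : coordIncl G x = coverCoord G i * coverCoord G j) :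
    Spec.map (CommRingCat.ofHom
      (HomogeneousLocalization.awayMap (coverGrading G) (coverCoord_mem G j) hx')) ≫
      chartProj G i =
    Spec.map (CommRingCat.ofHom (HomogeneousLocalization.Away.map (coordIncl G) x)) ≫
      Proj.awayι (Form k) x hx2 Nat.two_pos := by
  rw [chartProj, ← Category.assoc, ← Spec.map_comp, ← CommRingCat.ofHom_comp,
    awayMap_comp_map G i j hx hx', CommRingCat.ofHom_comp, Spec.map_comp, Category.assoc, chartMap,
    Proj.SpecMap_awayMap_awayι]

lemma chartProj_compat (i j : Fin 3) :
    pullback.fst ((coverCharts G).f i) ((coverCharts G).f j) ≫ chartProj G i =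
      pullback.snd ((coverCharts G).f i) ((coverCharts G).f j) ≫ chartProj G j := by
  have hx : coordIncl G (MvPolynomial.X i * MvPolynomial.X j) =
      coverCoord G i * coverCoord G j := map_mul (coordIncl G) _ _
  have hx2 : (MvPolynomial.X i * MvPolynomial.X j : CoordRing k) ∈ Form k 2 :=
    (X_mem k i).mul (X_mem k j)
  change pullback.fst (Proj.awayι _ _ (coverCoord_mem G i) Nat.one_pos)
      (Proj.awayι _ _ (coverCoord_mem G j) Nat.one_pos) ≫ _ =
    pullback.snd (Proj.awayι _ _ (coverCoord_mem G i) Nat.one_pos)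
      (Proj.awayι _ _ (coverCoord_mem G j) Nat.one_pos) ≫ _
  rw [← Proj.pullbackAwayιIso_hom_SpecMap_awayMap_left (coverGrading G) (coverCoord_mem G i)
      Nat.one_pos (coverCoord_mem G j) Nat.one_pos hx,
    ← Proj.pullbackAwayιIso_hom_SpecMap_awayMap_right (coverGrading G) (coverCoord_mem G i)
      Nat.one_pos (coverCoord_mem G j) Nat.one_pos hx, Category.assoc, Category.assoc,
    SpecMap_awayMap_chartProj G i j hx2 rfl hx,
    SpecMap_awayMap_chartProj G j i hx2 (mul_comm _ _) (hx.trans (mul_comm _ _))]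

/-- The double cover `π_G : Y_G ⟶ ℙ²`, induced by `k[X₀, X₁, X₂] → k[X₀, X₁, X₂][W] / (W² - G)`. -/
noncomputable def coverProj : coverSurface G ⟶ P2 k :=
  (coverCharts G).openCover.glueMorphisms (chartProj G) (chartProj_compat G)

end Cover

section Nodes

/-- A local ring with residue field `k` is an ordinary node (a rational double point of type `A₁`)
of a surface if its completion is isomorphic, as a ring, to
`k[[x, y, z]] / (xy - z²)`. -/
def IsOrdinaryNode (k R : Type*) [Field k] [CommRing R] [IsLocalRing R] : Prop :=
  Nonempty (AdicCompletion (IsLocalRing.maximalIdeal R) R ≃+*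
    (MvPowerSeries (Fin 3) k ⧸ Ideal.span
      {(MvPowerSeries.X 0 * MvPowerSeries.X 1 - MvPowerSeries.X 2 ^ 2 :
        MvPowerSeries (Fin 3) k)}))

/-- The singular points of a scheme: the points at which the local ring is not regular. -/
def singularPoints (Y : Scheme.{u}) : Set Y :=
  {y | ¬ IsRegularLocalRing (Y.presheaf.stalk y)}

/-- The locus `𝒰` of the nonzero sextic forms `G` such that the surface `Y_G` has `21` ordinary
nodes as its only singularities. -/
def nodalLocus (k : Type u) [Field k] : Set (Form k 6) :=
  {G | G ≠ 0 ∧ (singularPoints (coverSurface G)).ncard = 21 ∧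
    ∀ y ∈ singularPoints (coverSurface G),
      IsOrdinaryNode k ((coverSurface G).presheaf.stalk y)}

end Nodes

end PlaneDoubleCover

/-!
Each of the three conditions is compared with `∇G' = c ∇G` for a nonzero constant `c`. For the third
one, a form with vanishing partial derivatives over a perfect field of characteristic `2` is a
square.

As `6` is even, Euler's formula reads `X · ∇G = 0`. A common factor of the partial derivatives would
give infinitely many points of the plane over which the tangent space of `W² = G` is 3-dimensional,
so finiteness of the singular locus makes `∇G` primitive. By the exactness of Koszul complexes, the
quintic forms lying locally in the ideal of the partial derivatives then lie in their linear span.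
Hence `Z(dG) = Z(dG')` yields `∇G' = M ∇G` with a constant matrix `M`, and `X · ∇G' = 0` forces `M`
to be scalar.

An isomorphism over the plane sends the root of `G'` on a chart to `α + β √G` with `β` a unit, that
is, a constant; differentiating `G' = α² + β² G` gives `∇G' = β² ∇G`.
-/

namespace PlaneDoubleCover

section Syzygies

open MvPolynomial Matrix

/-- The entries of the vector `g` have no common factor. -/
def IsPrimitiveVector {ι R : Type*} [CommMonoid R] (g : ι → R) : Prop :=
  ∀ d, (∀ i, d ∣ g i) → IsUnit d

lemma IsPrimitiveVector.ne_zero {ι R : Type*} [CommMonoidWithZero R] [Nontrivial R] {g : ι → R}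
    (hg : IsPrimitiveVector g) : g ≠ 0 := by
  rintro rfl
  exact not_isUnit_zero (hg 0 fun _ => dvd_rfl)

lemma IsPrimitiveVector.exists_eq_smul {ι R : Type*} [Finite ι] [CommRing R] [IsDomain R]
    [UniqueFactorizationMonoid R] {g w : ι → R} (hg : IsPrimitiveVector g)
    (h : ∀ i j, g i * w j = g j * w i) : ∃ r : R, w = r • g := by
  classical
  have := Fintype.ofFinite ι
  let := UniqueFactorizationMonoid.toGCDMonoid R
  let := Classical.arbitrary (NormalizedGCDMonoid R)
  obtain ⟨i, hi⟩ := Function.ne_iff.mp hg.ne_zero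
  have hunit : IsUnit (Finset.univ.gcd g) := hg _ fun j => Finset.gcd_dvd (Finset.mem_univ j)
  have hdvd : g i ∣ Finset.univ.gcd g * w i :=
    (Finset.dvd_gcd fun j _ => Dvd.intro _ (h i j)).trans (Finset.gcd_mul_right' _ _ _).dvd
  obtain ⟨r, hr⟩ := hunit.dvd_mul_left.mp hdvd
  refine ⟨r, funext fun j => mul_left_cancel₀ hi ?_⟩
  rw [h i j, hr, Pi.smul_apply, smul_eq_mul]
  ring

lemma IsPrimitiveVector.exists_eq_smul_of_cross_eq_zero {R : Type*} [CommRing R] [IsDomain R]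
    [UniqueFactorizationMonoid R] {g w : Fin 3 → R} (hg : IsPrimitiveVector g)
    (h : g ⨯₃ w = 0) : ∃ r : R, w = r • g := by
  refine hg.exists_eq_smul fun i j => ?_
  have h12 : g 1 * w 2 - g 2 * w 1 = 0 := congrFun h 0
  have h20 : g 2 * w 0 - g 0 * w 2 = 0 := congrFun h 1
  have h01 : g 0 * w 1 - g 1 * w 0 = 0 := congrFun h 2
  fin_cases i <;> fin_cases j <;> simp only [Fin.zero_eta, Fin.mk_one, Fin.reduceFinMk] <;> grind

variable {R : Type*} [CommRing R]

lemma mem_span_X_of_X_mul_mem {σ : Type*} {s : Set σ} {i : σ} (hi : i ∉ s) {v : MvPolynomial σ R}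
    (h : X i * v ∈ Ideal.span (X '' s)) : v ∈ Ideal.span (X '' s) := by
  rw [mem_ideal_span_X_image] at h ⊢
  intro m hm
  obtain ⟨j, hj, hne⟩ := h (Finsupp.single i 1 + m) <| by
    rwa [mem_support_iff, coeff_X_mul, ← mem_support_iff]
  have hij : i ≠ j := fun e => hi (e ▸ hj)
  exact ⟨j, hj, by simpa [Finsupp.single_apply, hij] using hne⟩

variable [IsDomain R]

lemma koszul_exact {v : Fin 3 → MvPolynomial (Fin 3) R} (h : X ⬝ᵥ v = 0) : ∃ a, v = X ⨯₃ a := by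
  rw [vec3_dotProduct] at h
  obtain ⟨p, q, hpq⟩ : ∃ p q, p * X 1 + q * X 2 = v 0 := by
    rw [← Ideal.mem_span_pair, ← Set.image_pair]
    refine mem_span_X_of_X_mul_mem (i := 0) (by simp) ?_
    rw [Set.image_pair, Ideal.mem_span_pair]
    exact ⟨-v 1, -v 2, by linear_combination -h⟩
  obtain ⟨r, hr⟩ : X 2 ∣ v 1 + X 0 * p := by
    rw [← Ideal.mem_span_singleton, ← Set.image_singleton]
    refine mem_span_X_of_X_mul_mem (i := 1) (by simp) ?_
    rw [Set.image_singleton, Ideal.mem_span_singleton]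
    exact ⟨-v 2 - X 0 * q, by linear_combination h + X 0 * hpq⟩
  refine ⟨![r, -q, p], ?_⟩
  have hv : v = ![v 0, v 1, v 2] := List.ofFn_inj.mp rfl
  refine hv.trans (vec3_eq ?_ ?_ ?_) <;> simp only [cons_val]
  · linear_combination -hpq
  · linear_combination hr
  refine mul_left_cancel₀ (X_ne_zero (R := R) (2 : Fin 3)) ?_
  linear_combination h + X 0 * hpq - X 1 * hr

lemma isPrimitiveVector_X {σ : Type*} [Nontrivial σ] :
    IsPrimitiveVector (X : σ → MvPolynomial σ R) := by
  intro d hd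
  obtain ⟨i, j, hij⟩ := exists_pair_ne σ
  obtain hunit | hassoc := (X_prime (R := R) (i := i)).irreducible.dvd_iff.mp (hd i)
  · exact hunit
  · exact absurd (hassoc.dvd.trans (hd j)) (by simpa [X_dvd_X] using hij)

variable [UniqueFactorizationMonoid R] {g : Fin 3 → MvPolynomial (Fin 3) R}

lemma exists_cross_X_eq_smul (hg : IsPrimitiveVector g) (hX : X ⬝ᵥ g = 0)
    {s : Fin 3 → MvPolynomial (Fin 3) R} (hs : s ⬝ᵥ g = 0) :
    ∃ r : MvPolynomial (Fin 3) R, s ⨯₃ X = r • g :=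
  hg.exists_eq_smul_of_cross_eq_zero <| by
    rw [cross_cross_eq_smul_sub_smul', dotProduct_comm, hX, hs, zero_smul, zero_smul, sub_zero]

lemma exists_eq_smul_X_add_smul {a : Fin 3 → MvPolynomial (Fin 3) R}
    (hg : IsPrimitiveVector (X ⨯₃ a)) {s : Fin 3 → MvPolynomial (Fin 3) R}
    (hs : s ⬝ᵥ (X ⨯₃ a) = 0) : ∃ p q : MvPolynomial (Fin 3) R, s = p • X + q • a := by
  obtain ⟨r, hr⟩ := exists_cross_X_eq_smul hg (dot_self_cross X a) hs
  obtain ⟨p, hp⟩ := isPrimitiveVector_X.exists_eq_smul_of_cross_eq_zero (w := s + r • a) <| by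
    rw [map_add, map_smul, ← hr, cross_anticomm']
  exact ⟨p, -r, by rw [← hp, neg_smul, add_neg_cancel_right]⟩

/-- The syzygies of `g` form a free module, with basis `X` and `a` if `g = X × a`, so that the
Koszul complex with coefficients in it is exact in the middle as well. -/
lemma exists_syzygies_eq_cross (hg : IsPrimitiveVector g) (hX : X ⬝ᵥ g = 0)
    {s : Matrix (Fin 3) (Fin 3) (MvPolynomial (Fin 3) R)} (hs : s *ᵥ g = 0) (hXs : X ᵥ* s = 0) :
    ∃ t : Matrix (Fin 3) (Fin 3) (MvPolynomial (Fin 3) R),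
      t *ᵥ g = 0 ∧ ∀ l, s.col l = X ⨯₃ t.col l := by
  obtain ⟨a, rfl⟩ := koszul_exact hX
  choose p q hpq using fun i => exists_eq_smul_X_add_smul hg (congrFun hs i)
  obtain rfl : s = vecMulVec p X + vecMulVec q a := funext hpq
  rw [vecMul_add, vecMul_vecMulVec, vecMul_vecMulVec] at hXs
  have hq : X ⬝ᵥ q = 0 := by
    refine (smul_eq_zero.mp ?_).resolve_right hg.ne_zero
    simpa using congrArg (X ⨯₃ ·) hXs
  have hp : X ⬝ᵥ p = 0 := by
    rw [hq, zero_smul, add_zero] at hXs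
    exact (smul_eq_zero.mp hXs).resolve_right isPrimitiveVector_X.ne_zero
  obtain ⟨P, rfl⟩ := koszul_exact hp
  obtain ⟨Q, rfl⟩ := koszul_exact hq
  refine ⟨vecMulVec P X + vecMulVec Q a, ?_, fun l => ?_⟩
  · simp [add_mulVec, vecMulVec_mulVec]
  · have hcol (u v w z : Fin 3 → MvPolynomial (Fin 3) R) :
        (vecMulVec u v + vecMulVec w z).col l = v l • u + z l • w := by
      ext1 i
      simp [vecMulVec_apply, mul_comm (u i), mul_comm (w i)]
    simp only [hcol, map_add, map_smul]

lemma mem_span_of_forall_X_mul_mem (hg : IsPrimitiveVector g) (hX : X ⬝ᵥ g = 0)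
    {u : MvPolynomial (Fin 3) R} (hu : ∀ i, X i * u ∈ Ideal.span (Set.range g)) :
    u ∈ Ideal.span (Set.range g) := by
  simp only [Ideal.mem_span_range_iff_exists_fun] at hu ⊢
  choose b hb using hu
  have hbg : of b *ᵥ g = u • X := funext fun i => (hb i).trans (mul_comm _ _)
  let s : Matrix (Fin 3) (Fin 3) (MvPolynomial (Fin 3) R) := (of fun l => X ⨯₃ (of b).col l)ᵀ
  have hs : s *ᵥ g = X ⨯₃ (of b *ᵥ g) := by
    ext1 i
    fin_cases i <;> simp [s, cross_apply, mulVec, vec3_dotProduct] <;> ring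
  obtain ⟨t, htg, ht⟩ := exists_syzygies_eq_cross hg hX (s := s) (by simp [hs, hbg])
    (funext fun l => dot_self_cross X ((of b).col l))
  have hdiff (l) : ∃ e : MvPolynomial (Fin 3) R, (of b).col l - t.col l = e • X :=
    isPrimitiveVector_X.exists_eq_smul_of_cross_eq_zero <| by
      rw [map_sub, ← ht]; exact sub_self (X ⨯₃ (of b).col l)
  choose e he using hdiff
  refine ⟨e, mul_left_cancel₀ (X_ne_zero (R := R) (0 : Fin 3)) ?_⟩
  have hrow : of b - t = vecMulVec X e := by
    ext1 i l
    exact (congrFun (he l) i).trans (mul_comm _ _)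
  have h := congrFun (congrArg (· *ᵥ g) hrow) 0
  simp only [sub_mulVec, hbg, htg, vecMulVec_mulVec] at h
  simpa [dotProduct, mul_comm, eq_comm] using h

lemma mem_span_of_forall_X_pow_mul_mem (hg : IsPrimitiveVector g) (hX : X ⬝ᵥ g = 0)
    {u : MvPolynomial (Fin 3) R} (hu : ∀ i, ∃ n : ℕ, X i ^ n * u ∈ Ideal.span (Set.range g)) :
    u ∈ Ideal.span (Set.range g) := by
  set J := Ideal.span (Set.range g)
  set m : Ideal (MvPolynomial (Fin 3) R) := Ideal.span (Set.range X)
  have hrad : m ≤ (J.colon {u}).radical := by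
    rw [Ideal.span_le]
    rintro _ ⟨i, rfl⟩
    obtain ⟨n, hn⟩ := hu i
    exact ⟨n, Submodule.mem_colon_singleton.mpr hn⟩
  obtain ⟨n, hn⟩ := Ideal.exists_pow_le_of_le_radical_of_fg hrad
    (Submodule.fg_span (Set.finite_range _))
  have descend (n : ℕ) (h : ∀ t ∈ m ^ n, t * u ∈ J) : u ∈ J := by
    induction n with
    | zero => simpa using h 1 (by simp)
    | succ n ih =>
      refine ih fun t ht => mem_span_of_forall_X_mul_mem hg hX fun i => ?_
      rw [← mul_assoc]
      exact h _ (pow_succ' m n ▸ Ideal.mul_mem_mul (Ideal.subset_span ⟨i, rfl⟩) ht)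
  exact descend n fun t ht => Submodule.mem_colon_singleton.mp (hn ht)

end Syzygies

section Proportionality

open MvPolynomial Matrix

variable {σ R : Type*} [CommRing R]

lemma homogeneousComponent_mul_of_le {a b : MvPolynomial σ R} {i n : ℕ} (hb : b.IsHomogeneous i)
    (h : i ≤ n) : homogeneousComponent n (a * b) = homogeneousComponent (n - i) a * b := by
  let := gradedAlgebra (σ := σ) (R := R)
  simpa only [DirectSum.decompose, Equiv.coe_fn_mk, decomposition.decompose'_apply] using
    DirectSum.coe_decompose_mul_of_right_mem_of_le (homogeneousSubmodule σ R) (a := a) hb h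

lemma homogeneousComponent_mul_of_not_le {a b : MvPolynomial σ R} {i n : ℕ}
    (hb : b.IsHomogeneous i) (h : ¬ i ≤ n) : homogeneousComponent n (a * b) = 0 := by
  let := gradedAlgebra (σ := σ) (R := R)
  simpa only [DirectSum.decompose, Equiv.coe_fn_mk, decomposition.decompose'_apply] using
    DirectSum.coe_decompose_mul_of_right_mem_of_not_le (homogeneousSubmodule σ R) (a := a) hb h

lemma exists_eq_mulVec_of_mem_span {ι : Type*} [Fintype ι] {g g' : ι → MvPolynomial σ R} {n : ℕ}
    (hg : ∀ i, (g i).IsHomogeneous n) (hg' : ∀ i, (g' i).IsHomogeneous n)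
    (h : ∀ i, g' i ∈ Ideal.span (Set.range g)) : ∃ M : Matrix ι ι R, g' = M.map C *ᵥ g := by
  simp only [Ideal.mem_span_range_iff_exists_fun] at h
  choose b hb using h
  refine ⟨of fun i j => coeff 0 (b i j), funext fun i => ?_⟩
  have hn := congrArg (homogeneousComponent n) (hb i)
  rw [map_sum, homogeneousComponent_of_mem (hg' i), if_pos rfl] at hn
  simp only [homogeneousComponent_mul_of_le (hg _) le_rfl, Nat.sub_self,
    homogeneousComponent_zero] at hn
  exact hn.symm

lemma eq_scalar_of_X_vecMul_eq_smul {ι : Type*} [Fintype ι] [DecidableEq ι] {M : Matrix ι ι R}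
    {t : MvPolynomial ι R} (h : X ᵥ* M.map C = t • X) : M = scalar ι (coeff 0 t) := by
  ext m l
  have hml : coeff (Finsupp.single m 1) ((X ᵥ* M.map C) l) = M m l := by
    simp [vecMul, dotProduct, mul_comm (X _), coeff_sum, coeff_X, Finsupp.single_left_inj]
  rw [h, Pi.smul_apply, smul_eq_mul, coeff_mul_X'] at hml
  rw [← hml, scalar_apply, diagonal_apply]
  by_cases hm : m = l <;> simp [hm, eq_comm]

lemma exists_eq_C_smul [IsDomain R] [UniqueFactorizationMonoid R]
    {g g' : Fin 3 → MvPolynomial (Fin 3) R} {n : ℕ} (hn : 2 < n) (hg : IsPrimitiveVector g)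
    (hX : X ⬝ᵥ g = 0) (hdeg : ∀ i, (g i).IsHomogeneous n) (hX' : X ⬝ᵥ g' = 0)
    (hdeg' : ∀ i, (g' i).IsHomogeneous n)
    (h : ∀ i j, ∃ N : ℕ, X i ^ N * g' j ∈ Ideal.span (Set.range g)) :
    ∃ c : R, g' = (C c : MvPolynomial (Fin 3) R) • g := by
  obtain ⟨M, rfl⟩ := exists_eq_mulVec_of_mem_span hdeg hdeg' fun j =>
    mem_span_of_forall_X_pow_mul_mem hg hX fun i => h i j
  let s := X ᵥ* M.map C
  have hsdeg (l) : (s l).IsHomogeneous 1 :=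
    IsHomogeneous.sum _ _ _ fun i _ => (isHomogeneous_X R i).mul (isHomogeneous_C _ _)
  have hcrossdeg (l) : ((s ⨯₃ X) l).IsHomogeneous 2 := by
    have hdeg2 (i j) : (s i * X j - s j * X i).IsHomogeneous 2 :=
      ((hsdeg i).mul (isHomogeneous_X R j)).sub ((hsdeg j).mul (isHomogeneous_X R i))
    fin_cases l <;> exact hdeg2 _ _
  obtain ⟨r, hr⟩ := exists_cross_X_eq_smul hg hX (s := s) (by rw [← dotProduct_mulVec, hX'])
  have hcross : s ⨯₃ X = 0 := by
    ext1 l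
    have hl := congrArg (homogeneousComponent 2) (congrFun hr l)
    rwa [homogeneousComponent_of_mem (hcrossdeg l), if_pos rfl, Pi.smul_apply, smul_eq_mul,
      homogeneousComponent_mul_of_not_le (hdeg l) (by lia)] at hl
  obtain ⟨t, ht⟩ := isPrimitiveVector_X.exists_eq_smul_of_cross_eq_zero (w := s) <| by
    rw [← cross_anticomm, hcross, neg_zero]
  refine ⟨coeff 0 t, ?_⟩
  rw [eq_scalar_of_X_vecMul_eq_smul ht]
  ext1 i
  simp [mulVec, dotProduct, diagonal_apply, apply_ite C, ite_mul]

end Proportionality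

section Forms

open MvPolynomial

lemma eval_smul_of_isHomogeneous {σ R : Type*} [CommRing R] {n : ℕ} {F : MvPolynomial σ R}
    (hF : F.IsHomogeneous n) (c : R) (a : σ → R) : eval (c • a) F = c ^ n * eval a F := by
  rw [eval_eq, eval_eq, Finset.mul_sum]
  refine Finset.sum_congr rfl fun d hd => ?_
  have hdn : ∑ i ∈ d.support, d i = n := (hF.degree_eq_sum_deg_support hd).symm
  simp only [Pi.smul_apply, smul_eq_mul, mul_pow, Finset.prod_mul_distrib,
    Finset.prod_pow_eq_pow_sum, hdn]
  ring

lemma dvd_apply_of_pderiv_eq_zero {σ R : Type*} [CommRing R] [NoZeroDivisors R] (p : ℕ) [CharP R p]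
    {F : MvPolynomial σ R} {i : σ} (h : pderiv i F = 0) {m : σ →₀ ℕ} (hm : m ∈ F.support) :
    p ∣ m i := by
  rcases Nat.eq_zero_or_pos (m i) with h0 | h0
  · simp [h0]
  have hle : Finsupp.single i 1 ≤ m := Finsupp.single_le_iff.mpr h0
  have hcoeff := congrArg (coeff (m - Finsupp.single i 1)) h
  rw [coeff_pderiv, tsub_add_cancel_of_le hle, coeff_zero, mul_eq_zero] at hcoeff
  have hcast := hcoeff.resolve_left (mem_support_iff.mp hm)
  rw [Finsupp.tsub_apply, Finsupp.single_eq_same, Nat.cast_sub h0, Nat.cast_one,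
    sub_add_cancel] at hcast
  exact (CharP.cast_eq_zero_iff R p _).mp hcast

lemma exists_eq_pow_of_pderiv_eq_zero {σ R : Type*} [CommRing R] [NoZeroDivisors R] (p : ℕ)
    [Fact p.Prime] [CharP R p] [PerfectRing R p] {n : ℕ} {F : MvPolynomial σ R}
    (hF : F.IsHomogeneous (p * n)) (h : ∀ i, pderiv i F = 0) :
    ∃ H : MvPolynomial σ R, H.IsHomogeneous n ∧ F = H ^ p := by
  let root (m : σ →₀ ℕ) : σ →₀ ℕ := m.mapRange (· / p) (Nat.zero_div p)
  have hroot (m) (hm : m ∈ F.support) : p • root m = m := by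
    ext i
    simp [root, Nat.mul_div_cancel' (dvd_apply_of_pderiv_eq_zero p (h i) hm)]
  refine ⟨∑ m ∈ F.support, monomial (root m) ((frobeniusEquiv R p).symm (coeff m F)), ?_, ?_⟩
  · refine IsHomogeneous.sum _ _ _ fun m hm => isHomogeneous_monomial _ ?_
    have hdeg : m.degree = p * n := (hF.degree_eq_sum_deg_support hm).symm
    rw [← hroot m hm, map_nsmul, smul_eq_mul] at hdeg
    exact Nat.eq_of_mul_eq_mul_left (NeZero.pos p) hdeg
  · rw [sum_pow_char]
    conv_lhs => rw [F.as_sum]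
    refine Finset.sum_congr rfl fun m hm => ?_
    rw [monomial_pow, hroot m hm, frobeniusEquiv_symm_pow_p]

lemma homogeneousComponent_add_mul {σ R : Type*} [CommRing R] {p q : MvPolynomial σ R} {m n : ℕ}
    (hp : p.totalDegree ≤ m) (hq : q.totalDegree ≤ n) :
    homogeneousComponent (m + n) (p * q) =
      homogeneousComponent m p * homogeneousComponent n q := by
  have hterm (i) : homogeneousComponent (m + n) (homogeneousComponent i p * q) =
      if i = m then homogeneousComponent m p * homogeneousComponent n q else 0 := by
    have hi := homogeneousComponent_isHomogeneous i p
    rw [mul_comm]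
    split_ifs with him
    · rw [him, homogeneousComponent_mul_of_le (him ▸ hi) (by lia), Nat.add_sub_cancel_left,
        mul_comm]
    by_cases hle : i ≤ m + n
    · rw [homogeneousComponent_mul_of_le hi hle]
      rcases lt_or_gt_of_ne him with hlt | hgt
      · rw [homogeneousComponent_eq_zero _ q (by lia), zero_mul]
      · rw [homogeneousComponent_eq_zero _ p (by lia), mul_zero]
    · exact homogeneousComponent_mul_of_not_le hi hle
  conv_lhs => rw [← sum_homogeneousComponent p, Finset.sum_mul, map_sum]
  rw [Finset.sum_congr rfl fun i _ => hterm i, Finset.sum_ite_eq']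
  split_ifs with hm
  · rfl
  · rw [homogeneousComponent_eq_zero _ p (by simpa using hm), zero_mul]

lemma homogeneousComponent_totalDegree_dvd {σ R : Type*} [CommRing R] [IsDomain R]
    {p F : MvPolynomial σ R} {n : ℕ} (hF : F.IsHomogeneous n) (h : p ∣ F) :
    homogeneousComponent p.totalDegree p ∣ F := by
  obtain ⟨q, rfl⟩ := h
  by_cases h0 : p * q = 0
  · exact h0 ▸ dvd_zero _
  have hdeg := hF.totalDegree h0
  rw [totalDegree_mul_of_isDomain (left_ne_zero_of_mul h0) (right_ne_zero_of_mul h0)] at hdeg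
  have htop := homogeneousComponent_add_mul (p := p) (q := q) le_rfl le_rfl
  rw [hdeg, homogeneousComponent_of_mem hF, if_pos rfl] at htop
  exact Dvd.intro _ htop.symm

lemma homogeneousComponent_totalDegree_ne_zero {σ R : Type*} [CommRing R] {p : MvPolynomial σ R}
    (hp : p ≠ 0) : homogeneousComponent p.totalDegree p ≠ 0 := by
  obtain ⟨m, hm, hdeg⟩ := Finset.exists_mem_eq_sup p.support (support_nonempty.mpr hp)
    fun m => m.sum fun _ e => e
  refine fun h0 => mem_support_iff.mp hm ?_
  have hcoeff := congrArg (coeff m) h0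
  have htop : m.degree = p.totalDegree := hdeg.symm
  rwa [coeff_homogeneousComponent, if_pos htop, coeff_zero] at hcoeff

lemma coeff_aeval_linear {σ R : Type*} [CommRing R] {e : ℕ} {p : MvPolynomial σ R}
    (hp : p.IsHomogeneous e) (Q b : σ → R) :
    (aeval (fun i => Polynomial.C (Q i) * Polynomial.X + Polynomial.C (b i)) p).coeff e =
      eval Q p := by
  classical
  rw [aeval_def, eval₂_eq, eval_eq, Polynomial.finsetSum_coeff]
  refine Finset.sum_congr rfl fun d hd => ?_
  have hprod {S : Type _} [CommRing S] (f : σ → S) :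
      ∏ i ∈ d.support, f i ^ d i = (d.toMultiset.map f).prod := by
    simp only [Finset.prod_multiset_map_count, Finsupp.toFinset_toMultiset,
      Finsupp.count_toMultiset]
  have hcard : (d.toMultiset.map fun i =>
      Polynomial.C (Q i) * Polynomial.X + Polynomial.C (b i)).card * 1 = e := by
    rw [mul_one, Multiset.card_map, Finsupp.card_toMultiset]
    exact (hp.degree_eq_sum_deg_support hd).symm
  rw [Polynomial.algebraMap_eq, Polynomial.coeff_C_mul, hprod, hprod, ← hcard,
    Polynomial.coeff_multiset_prod_of_natDegree_le _ _ ?_, Multiset.map_map]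
  · simp
  · simp only [Multiset.mem_map, forall_exists_index, and_imp]
    rintro _ i - rfl
    exact Polynomial.natDegree_linear_le

lemma exists_eval_smul_add_eq_zero {σ k : Type*} [Field k] [IsAlgClosed k] {e : ℕ} (he : e ≠ 0)
    {p : MvPolynomial σ k} (hp : p.IsHomogeneous e) {Q : σ → k} (hQ : eval Q p ≠ 0) (b : σ → k) :
    ∃ u : k, eval (u • Q + b) p = 0 := by
  set f : Polynomial k :=
    aeval (fun i => Polynomial.C (Q i) * Polynomial.X + Polynomial.C (b i)) p with hf
  have hcoeff : f.coeff e ≠ 0 := by rwa [hf, coeff_aeval_linear hp]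
  obtain ⟨u, hu⟩ := IsAlgClosed.exists_root f fun h0 => hcoeff <|
    Polynomial.coeff_eq_zero_of_degree_lt (h0 ▸ by exact_mod_cast Nat.pos_of_ne_zero he)
  refine ⟨u, ?_⟩
  rw [Polynomial.IsRoot, ← Polynomial.coe_aeval_eq_eval, hf, ← AlgHom.comp_apply, comp_aeval,
    aeval_eq_eval] at hu
  rwa [show u • Q + b = fun i => Polynomial.aeval u
    (Polynomial.C (Q i) * Polynomial.X + Polynomial.C (b i)) by
      ext i
      simp only [Pi.add_apply, Pi.smul_apply, smul_eq_mul, map_add, map_mul, Polynomial.aeval_C,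
        Polynomial.aeval_X, Algebra.algebraMap_self, RingHom.id_apply, mul_comm (u)]]

section Lines

variable {k : Type*} [Field k]

/-- The points of the line through two coordinate vertices other than the `i`th, without one of
these vertices. -/
def pointOnLine (i : Fin 3) (t : k) : Fin 3 → k :=
  Pi.single (i + 1) 1 + Pi.single (i + 2) t

lemma pointOnLine_apply (i : Fin 3) (t : k) :
    pointOnLine i t i = 0 ∧ pointOnLine i t (i + 1) = 1 ∧ pointOnLine i t (i + 2) = t := by
  fin_cases i <;> simp [pointOnLine]

lemma smul_add_pointOnLine_ne_zero {i : Fin 3} {Q : Fin 3 → k} (hi : Q i ≠ 0) (u t : k) :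
    u • Q + pointOnLine i t ≠ 0 := fun h => by
  have h0 := congrFun h i
  have h1 := congrFun h (i + 1)
  simp_all [pointOnLine_apply]

lemma eq_of_smul_add_pointOnLine_eq {i : Fin 3} {Q : Fin 3 → k} (hi : Q i ≠ 0)
    {c c' u u' t t' : k} (hc : c ≠ 0)
    (h : c • (u • Q + pointOnLine i t) = c' • (u' • Q + pointOnLine i t')) : t = t' := by
  have h0 := congrFun h i
  have h1 := congrFun h (i + 1)
  have h2 := congrFun h (i + 2)
  simp only [Pi.smul_apply, Pi.add_apply, smul_eq_mul, pointOnLine_apply] at h0 h1 h2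
  have hu : c * u = c' * u' := mul_right_cancel₀ hi (by linear_combination h0)
  obtain rfl : c = c' := by linear_combination h1 - Q (i + 1) * hu
  exact mul_left_cancel₀ hc (by linear_combination h2 - Q (i + 2) * hu)

end Lines

variable {k : Type*} [Field k] [IsAlgClosed k]

-- The lines joining a point `Q` off the curve to the points of a fixed line cut the curve in
-- distinct points.
lemma exists_infinite_zeros {e : ℕ} (he : e ≠ 0) {p : CoordRing k} (hp : p.IsHomogeneous e)
    (h0 : p ≠ 0) : ∃ i, {a : Fin 3 → k | a i = 1 ∧ eval a p = 0}.Infinite := by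
  have : Infinite k := IsAlgClosed.instInfinite
  obtain ⟨Q, hQ⟩ : ∃ Q : Fin 3 → k, eval Q p ≠ 0 := by
    by_contra! h
    exact h0 (MvPolynomial.funext (by simpa using h))
  obtain ⟨i, hi⟩ : ∃ i, Q i ≠ 0 := by
    by_contra! h
    have hQ0 : eval Q p = 0 ^ e * eval Q p := by
      rw [← eval_smul_of_isHomogeneous hp, zero_smul, show Q = 0 from funext h]
    simp [he, hQ] at hQ0
  choose u hu using fun t => exists_eval_smul_add_eq_zero he hp hQ (pointOnLine i t)
  choose j hj using fun t => Function.ne_iff.mp (smul_add_pointOnLine_ne_zero hi (u t) t)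
  let point (t : k) : Fin 3 → k :=
    ((u t • Q + pointOnLine i t) (j t))⁻¹ • (u t • Q + pointOnLine i t)
  have hinj : Function.Injective point := fun t _ h =>
    eq_of_smul_add_pointOnLine_eq hi (inv_ne_zero (hj t)) h
  by_contra! hfin
  refine Set.infinite_of_injective_forall_mem hinj
    (s := ⋃ i, {a : Fin 3 → k | a i = 1 ∧ eval a p = 0})
    (fun t => Set.mem_iUnion.mpr ⟨j t, inv_mul_cancel₀ (hj t), ?_⟩) (Set.finite_iUnion hfin)
  rw [eval_smul_of_isHomogeneous hp, hu, mul_zero]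

lemma exists_infinite_common_zeros {ι : Type*} {g : ι → CoordRing k} {n : ℕ}
    (hdeg : ∀ j, (g j).IsHomogeneous n) (hg : ¬ IsPrimitiveVector g) :
    ∃ i, {a : Fin 3 → k | a i = 1 ∧ ∀ j, eval a (g j) = 0}.Infinite := by
  obtain ⟨e, he, p, hp, hp0, hdvd⟩ : ∃ e, e ≠ 0 ∧ ∃ p : CoordRing k,
      p.IsHomogeneous e ∧ p ≠ 0 ∧ ∀ j, p ∣ g j := by
    simp only [IsPrimitiveVector, not_forall] at hg
    obtain ⟨d, hd, hunit⟩ := hg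
    by_cases hd0 : d = 0
    · have hg0 (j) : g j = 0 := zero_dvd_iff.mp (hd0 ▸ hd j)
      exact ⟨1, one_ne_zero, X 0, isHomogeneous_X k 0, X_ne_zero 0, fun j => hg0 j ▸ dvd_zero _⟩
    · refine ⟨d.totalDegree, fun he => hunit ?_, _, homogeneousComponent_isHomogeneous _ d,
        homogeneousComponent_totalDegree_ne_zero hd0,
        fun j => homogeneousComponent_totalDegree_dvd (hdeg j) (hd j)⟩
      rw [totalDegree_eq_zero_iff_eq_C.mp he] at hd0 ⊢
      exact (isUnit_iff_ne_zero.mpr fun h => hd0 (by rw [h, C_0])).map C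
  obtain ⟨i, hi⟩ := exists_infinite_zeros he hp hp0
  refine ⟨i, hi.mono fun a ha => ⟨ha.1, fun j => ?_⟩⟩
  exact zero_dvd_iff.mp (ha.2 ▸ map_dvd (eval a) (hdvd j))

end Forms

section Dehomogenization

open HomogeneousLocalization

variable {A σ T : Type*} [CommRing A] [SetLike σ A] [AddSubgroupClass σ A] [CommRing T]
  (𝒜 : ℕ → σ) [GradedRing 𝒜] {f : A}

/-- The ring homomorphism `A_(f) → T` induced by a ring homomorphism `A → T` sending `f` to `1`. -/
noncomputable def awayEval (φ : A →+* T) (hφ : φ f = 1) : Away 𝒜 f →+* T :=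
  (Localization.awayLift φ f (hφ ▸ isUnit_one)).comp (algebraMap (Away 𝒜 f) (Localization.Away f))

lemma awayEval_mk (φ : A →+* T) (hφ : φ f = 1) {d : ℕ} (hf : f ∈ 𝒜 d) {n : ℕ} {a : A}
    (ha : a ∈ 𝒜 (n • d)) : awayEval 𝒜 φ hφ (Away.mk 𝒜 hf n a ha) = φ a := by
  rw [awayEval, RingHom.comp_apply, HomogeneousLocalization.algebraMap_apply, Away.val_mk,
    Localization.awayLift_mk (v := 1) (hv := by simp [hφ])]
  simp

variable {𝒜} (hf : f ∈ 𝒜 1)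

/-- Dehomogenization with respect to an element `f` of degree one: the ring homomorphism
`A → A_(f)` that sends a homogeneous element `a` of degree `n` to `a / fⁿ`. -/
noncomputable def toAway : A →+* Away 𝒜 f :=
  (DirectSum.toSemiring (fun n =>
    { toFun := fun a : 𝒜 n => Away.mk 𝒜 hf n a (by simp)
      map_zero' := by ext; simp [Localization.mk_zero]
      map_add' := fun a b => by ext; simp [Localization.add_mk_self] })
    (by ext; simp) (fun a b => by ext; simp [Localization.mk_mul, pow_add])).comp
    (DirectSum.decomposeRingEquiv 𝒜).toRingHom

lemma toAway_of_mem {n : ℕ} {a : A} (ha : a ∈ 𝒜 n) :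
    toAway hf a = Away.mk 𝒜 hf n a (by simpa using ha) := by
  have hdec : DirectSum.decomposeRingEquiv 𝒜 a = DirectSum.of (fun n => 𝒜 n) n ⟨a, ha⟩ :=
    DirectSum.decompose_of_mem 𝒜 ha
  rw [toAway, RingHom.comp_apply, RingEquiv.toRingHom_eq_coe, RingEquiv.coe_toRingHom, hdec,
    DirectSum.toSemiring_of]
  rfl

lemma val_toAway {n : ℕ} {a : A} (ha : a ∈ 𝒜 n) :
    (toAway hf a).val =
      Localization.mk a (⟨f ^ n, n, rfl⟩ : Submonoid.powers f) := by
  rw [toAway_of_mem hf ha, Away.val_mk]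

lemma toAway_self : toAway hf f = 1 := by
  ext
  rw [val_toAway hf hf, val_one]
  convert Localization.mk_self (⟨f, 1, pow_one f⟩ : Submonoid.powers f)
  exact Subtype.ext (pow_one f)

lemma algebraMap_eq_toAway (c : 𝒜 0) : algebraMap (𝒜 0) (Away 𝒜 f) c = toAway hf c := by
  ext
  rw [val_toAway hf c.2]
  exact congrArg (Localization.mk (c : A)) (Subtype.ext (pow_zero f).symm)

lemma exists_eq_toAway (s : Away 𝒜 f) : ∃ n, ∃ a ∈ 𝒜 n, s = toAway hf a := by
  obtain ⟨n, a, ha, rfl⟩ := Away.mk_surjective 𝒜 hf s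
  have ha' : a ∈ 𝒜 n := by simpa using ha
  exact ⟨n, a, ha', (toAway_of_mem hf ha').symm⟩

lemma ringHom_ext_of_homogeneous {φ ψ : A →+* T} (h : ∀ n, ∀ a ∈ 𝒜 n, φ a = ψ a) : φ = ψ := by
  ext a
  induction a using DirectSum.Decomposition.inductionOn 𝒜 with
  | zero => rw [map_zero, map_zero]
  | homogeneous a => exact h _ a a.2
  | add a b ha hb => rw [map_add, map_add, ha, hb]

lemma awayEval_toAway (φ : A →+* T) (hφ : φ f = 1) (a : A) :
    awayEval 𝒜 φ hφ (toAway hf a) = φ a := by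
  refine DFunLike.congr_fun (ringHom_ext_of_homogeneous (𝒜 := 𝒜)
    (φ := (awayEval 𝒜 φ hφ).comp (toAway hf)) fun n a ha => ?_) a
  rw [RingHom.comp_apply, toAway_of_mem hf ha, awayEval_mk]

lemma map_toAway {B τ : Type*} [CommRing B] [SetLike τ B] [AddSubgroupClass τ B] {ℬ : ℕ → τ}
    [GradedRing ℬ] (g : 𝒜 →+*ᵍ ℬ) (hgf : g f ∈ ℬ 1) (a : A) :
    Away.map g f (toAway hf a) = toAway hgf (g a) := by
  refine DFunLike.congr_fun (ringHom_ext_of_homogeneous (𝒜 := 𝒜)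
    (φ := (Away.map g f).comp (toAway hf)) (ψ := (toAway hgf).comp (g : A →+* B))
    fun n a ha => ?_) a
  have hga : g a ∈ ℬ n := g.map_mem ha
  simp only [RingHom.comp_apply, RingHom.coe_coe]
  rw [toAway_of_mem hf ha, toAway_of_mem hgf hga, Away.map_mk]

lemma awayMap_toAway {g x : A} (hg : g ∈ 𝒜 1) (hx : x = f * g) (hx' : x = g * f) {n : ℕ} {a : A}
    (ha : a ∈ 𝒜 n) :
    awayMap 𝒜 hg hx (toAway hf a) =
      awayMap 𝒜 hg hx (toAway hf (g ^ n)) * awayMap 𝒜 hf hx' (toAway hg a) := by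
  have hgn : g ^ n ∈ 𝒜 n := by simpa using SetLike.pow_mem_graded n hg
  rw [toAway_of_mem hf ha, toAway_of_mem hf hgn, toAway_of_mem hg ha, awayMap_mk, awayMap_mk,
    awayMap_mk]
  ext
  simp only [Away.val_mk, val_mul, Localization.mk_mul, Localization.mk_eq_mk_iff,
    Localization.r_iff_exists, Submonoid.coe_mul]
  exact ⟨1, by rw [hx]; ring⟩

lemma exists_pow_mul_mem_of_toAway_mem {I : Ideal A} (hI : I.IsHomogeneous 𝒜) {n : ℕ} {u : A}
    (hu : u ∈ 𝒜 n) (h : toAway hf u ∈ I.map (toAway hf)) : ∃ N, f ^ N * u ∈ I := by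
  have hle : I.map (toAway hf) ≤ (I.map (algebraMap A (Localization.Away f))).comap
      (algebraMap (Away 𝒜 f) (Localization.Away f)) := by
    classical
    refine Ideal.map_le_iff_le_comap.mpr fun a ha => ?_
    rw [← DirectSum.sum_support_decompose 𝒜 a]
    refine Ideal.sum_mem _ fun m _ => ?_
    rw [Ideal.mem_comap, Ideal.mem_comap, HomogeneousLocalization.algebraMap_apply,
      val_toAway hf (SetLike.coe_mem _), Localization.mk_eq_mk',
      IsLocalization.mk'_mem_map_algebraMap_iff (Submonoid.powers f)]
    exact ⟨1, one_mem _, by simpa using hI m ha⟩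
  have hmem := hle h
  rw [Ideal.mem_comap, HomogeneousLocalization.algebraMap_apply, val_toAway hf hu,
    Localization.mk_eq_mk', IsLocalization.mk'_mem_map_algebraMap_iff (Submonoid.powers f)] at hmem
  obtain ⟨_, ⟨N, rfl⟩, hN⟩ := hmem
  exact ⟨N, hN⟩

end Dehomogenization

section Gradient

open MvPolynomial

/-- The vector of the partial derivatives of a polynomial. -/
noncomputable def gradient {σ R : Type*} [CommRing R] (F : MvPolynomial σ R) :
    σ → MvPolynomial σ R :=
  fun l => pderiv l F

lemma gradient_isHomogeneous {σ R : Type*} [CommRing R] {n : ℕ} {F : MvPolynomial σ R}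
    (hF : F.IsHomogeneous n) (l : σ) : (gradient F l).IsHomogeneous (n - 1) :=
  hF.pderiv

lemma X_dotProduct_gradient {σ R : Type*} [CommRing R] [Fintype σ] {n : ℕ} {F : MvPolynomial σ R}
    (hF : F.IsHomogeneous n) (hn : (n : R) = 0) : (X : σ → MvPolynomial σ R) ⬝ᵥ gradient F = 0 := by
  have hsum := hF.sum_X_mul_pderiv
  rwa [nsmul_eq_mul, ← map_natCast C, hn, C_0, zero_mul] at hsum

end Gradient

section Charts

open MvPolynomial HomogeneousLocalization

variable {k : Type*} [Field k]

/-- The function `a / Xᵢⁿ` on the chart `{Xᵢ ≠ 0}`, for a form `a` of degree `n`, extended to a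
ring homomorphism on all polynomials. -/
noncomputable abbrev toChart (i : Fin 3) : CoordRing k →+* ChartRing k i := toAway (X_mem k i)

/-- The substitution `Xᵢ = 1`, which identifies the functions on a chart with polynomials. -/
noncomputable def toPoly (i : Fin 3) : ChartRing k i →+* CoordRing k :=
  awayEval (Form k) (aeval (R := k) (Function.update X i 1)).toRingHom (by simp)

lemma toPoly_toChart (i : Fin 3) (F : CoordRing k) :
    toPoly i (toChart i F) = aeval (Function.update X i 1) F :=
  awayEval_toAway _ _ _ _

lemma toChart_toPoly {i : Fin 3} (s : ChartRing k i) : toChart i (toPoly i s) = s := by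
  have hcomp : (toChart (k := k) i).comp (aeval (R := k) (Function.update X i 1)).toRingHom =
      toChart i := by
    refine MvPolynomial.ringHom_ext (fun c => by simp) fun l => ?_
    rcases eq_or_ne l i with rfl | hl
    · simp [toAway_self]
    · simp [hl]
  obtain ⟨n, F, -, rfl⟩ := exists_eq_toAway (X_mem k i) s
  rw [toPoly_toChart]
  exact DFunLike.congr_fun hcomp F

lemma toPoly_algebraMap (i : Fin 3) (c : Form k 0) :
    toPoly i (algebraMap (Form k 0) (ChartRing k i) c) = C (coeff 0 (c : CoordRing k)) := by
  have hc : (c : CoordRing k) = C (coeff 0 (c : CoordRing k)) :=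
    totalDegree_eq_zero_iff_eq_C.mp (Nat.le_zero.mp (IsHomogeneous.totalDegree_le c.2))
  rw [algebraMap_eq_toAway (X_mem k i), toPoly_toChart, hc]
  simp

lemma toChart_eq_zero_iff {i : Fin 3} {n : ℕ} {F : CoordRing k} (hF : F ∈ Form k n) :
    toChart i F = 0 ↔ F = 0 := by
  refine ⟨fun h => ?_, fun h => h ▸ map_zero _⟩
  obtain ⟨N, hN⟩ := exists_pow_mul_mem_of_toAway_mem (X_mem k i) (I := ⊥)
    (Ideal.IsHomogeneous.bot _) hF (h ▸ zero_mem _)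
  exact (mul_eq_zero.mp hN).resolve_left (pow_ne_zero N (X_ne_zero i))

lemma exists_eq_toChart_C_of_isUnit {i : Fin 3} {s : ChartRing k i} (hs : IsUnit s) :
    ∃ c : k, c ≠ 0 ∧ s = toChart i (C c) := by
  obtain ⟨c, hc, h⟩ := MvPolynomial.isUnit_iff_eq_C_of_isReduced.mp (hs.map (toPoly i))
  exact ⟨c, hc.ne_zero, by rw [← h, toChart_toPoly]⟩

lemma derivation_toChart {i : Fin 3} (θ : Derivation (Form k 0) (ChartRing k i) (ChartRing k i))
    (F : CoordRing k) :
    θ (toChart i F) = ∑ j, toChart i (gradient F j) * θ (toChart i (X j)) := by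
  induction F using MvPolynomial.induction_on with
  | C c =>
    have hc := algebraMap_eq_toAway (X_mem k i) ⟨C c, isHomogeneous_C _ c⟩
    rw [← hc, θ.map_algebraMap]
    simp [gradient]
  | add p q hp hq =>
    simp only [gradient, map_add, add_mul, Finset.sum_add_distrib] at hp hq ⊢
    rw [hp, hq]
  | mul_X p l hp =>
    have hterm (j) : toChart i (gradient (p * X l) j) * θ (toChart i (X j)) =
        (if j = l then toChart i p * θ (toChart i (X j)) else 0) +
          toChart i (X l) * (toChart i (gradient p j) * θ (toChart i (X j))) := by
      simp only [gradient, pderiv_mul, map_add, map_mul]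
      rcases eq_or_ne j l with rfl | hj
      · rw [pderiv_X_self, if_pos rfl, map_one]
        ring
      · rw [pderiv_X_of_ne hj.symm, if_neg hj, map_zero]
        ring
    rw [map_mul, θ.leibniz, hp, Finset.sum_congr rfl fun j _ => hterm j, Finset.sum_add_distrib,
      Finset.sum_ite_eq', if_pos (Finset.mem_univ l), ← Finset.mul_sum, smul_eq_mul, smul_eq_mul]

/-- The partial derivative with respect to the affine coordinate `Xₗ / Xᵢ`, for `l ≠ i`. -/
noncomputable def chartDeriv (i l : Fin 3) :
    Derivation (Form k 0) (ChartRing k i) (ChartRing k i) :=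
  .mk'
    { toFun := fun s => toChart i (pderiv l (toPoly i s))
      map_add' := fun s t => by simp only [map_add]
      map_smul' := fun c s => by
        rw [Algebra.smul_def, map_mul, toPoly_algebraMap, pderiv_C_mul, map_mul,
          ← toPoly_algebraMap, toChart_toPoly, RingHom.id_apply, Algebra.smul_def] }
    fun s t => by
      simp only [LinearMap.coe_mk, AddHom.coe_mk, map_mul, pderiv_mul, map_add, toChart_toPoly,
        smul_eq_mul]
      ring

lemma chartDeriv_toChart {i l : Fin 3} (hl : l ≠ i) (F : CoordRing k) :
    chartDeriv i l (toChart i F) = toChart i (gradient F l) := by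
  have hX (j) : chartDeriv i l (toChart i (X j) : ChartRing k i) = if j = l then 1 else 0 := by
    change toChart i (pderiv l (toPoly i (toChart i (X j)))) = _
    rw [toPoly_toChart, aeval_X]
    rcases eq_or_ne j i with rfl | hj
    · simp [hl.symm]
    · rw [Function.update_of_ne hj, pderiv_X]
      rcases eq_or_ne j l with rfl | hjl <;> simp [*]
  simp [derivation_toChart, hX]

/-- The ideal generated by the partial derivatives of a form. -/
noncomputable abbrev jacobianIdeal (F : CoordRing k) : Ideal (CoordRing k) :=
  Ideal.span (Set.range (gradient F))

lemma jacobianIdeal_isHomogeneous {n : ℕ} {F : CoordRing k} (hF : F.IsHomogeneous n) :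
    (jacobianIdeal F).IsHomogeneous (Form k) := by
  refine Ideal.homogeneous_span _ _ ?_
  rintro _ ⟨l, rfl⟩
  exact ⟨n - 1, gradient_isHomogeneous hF l⟩

lemma zeroIdeal_D_toChart {F : CoordRing k} (hF : (X : Fin 3 → CoordRing k) ⬝ᵥ gradient F = 0)
    (i : Fin 3) :
    zeroIdeal (A := ChartRing k i)
        (KaehlerDifferential.D (Form k 0) (ChartRing k i) (toChart i F)) =
      (jacobianIdeal F).map (toChart i) := by
  set I := zeroIdeal (A := ChartRing k i)
    (KaehlerDifferential.D (Form k 0) (ChartRing k i) (toChart i F))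
  refine le_antisymm ?_ ?_
  · rintro _ ⟨f, rfl⟩
    change f.compDer (KaehlerDifferential.D (Form k 0) (ChartRing k i)) (toChart i F) ∈ _
    rw [derivation_toChart]
    exact Ideal.sum_mem _ fun j _ => Ideal.mul_mem_right _ _
      (Ideal.mem_map_of_mem _ (Ideal.subset_span ⟨j, rfl⟩))
  · have hmem (l) (hl : l ≠ i) : toChart i (gradient F l) ∈ I :=
      ⟨(chartDeriv i l).liftKaehlerDifferential, by
        rw [Module.Dual.eval_apply, Derivation.liftKaehlerDifferential_comp_D,
          chartDeriv_toChart hl]⟩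
    rw [Ideal.map_span, Ideal.span_le]
    rintro _ ⟨_, ⟨l, rfl⟩, rfl⟩
    rcases eq_or_ne l i with rfl | hl
    · have hsum := congrArg (toChart l) hF
      rw [dotProduct, map_sum, map_zero, ← Finset.add_sum_erase _ _ (Finset.mem_univ l), map_mul,
        toAway_self, one_mul] at hsum
      rw [SetLike.mem_coe, eq_neg_of_add_eq_zero_left hsum]
      refine neg_mem (Ideal.sum_mem _ fun j hj => ?_)
      rw [map_mul]
      exact Ideal.mul_mem_left _ _ (hmem j (Finset.ne_of_mem_erase hj))
    · exact hmem l hl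

end Charts

section IdealSheaves

open Scheme.IdealSheafData

universe u

lemma comap_ker_of_isOpenImmersion {X Y V : Scheme} (f : X ⟶ Y) [QuasiCompact f] (c : V ⟶ Y)
    [IsOpenImmersion c] : f.ker.comap c = (pullback.fst c f).ker := by
  refine Scheme.IdealSheafData.ext (funext fun U => ?_)
  rw [ideal_comap_of_isOpenImmersion]
  exact (Scheme.ker_ideal_of_isPullback_of_isOpenImmersion f _ _ c
    (IsPullback.of_hasPullback c f) U).symm

lemma comap_iInf_of_isOpenImmersion {Y V : Scheme} {ι : Type*} [Finite ι]
    (I : ι → Y.IdealSheafData) (c : V ⟶ Y) [IsOpenImmersion c] :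
    (⨅ j, I j).comap c = ⨅ j, (I j).comap c := by
  refine Scheme.IdealSheafData.ext (funext fun U => ?_)
  simp only [ideal_comap_of_isOpenImmersion, ideal_iInf, iInf_apply, Ideal.comap_iInf]

/-- The ideal sheaf on an affine scheme defined by an ideal. -/
noncomputable def idealSheaf {A : Type u} [CommRing A] (I : Ideal A) :
    (Spec (.of A)).IdealSheafData :=
  ofIdealTop (I.comap (Scheme.ΓSpecIso (.of A)).hom.hom)

lemma idealSheaf_le_idealSheaf_iff {A : Type u} [CommRing A] {I J : Ideal A} :
    idealSheaf I ≤ idealSheaf J ↔ I ≤ J :=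
  (map_le_map_iff equivOfIsAffine.symm).trans
    (Ideal.comap_le_comap_iff_of_surjective _
      (Scheme.ΓSpecIso (.of A)).commRingCatIsoToRingEquiv.surjective I J)

/-- The ring homomorphism corresponding to a morphism to an affine scheme. -/
noncomputable def globalSections {A : Type u} [CommRing A] {X : Scheme.{u}}
    (f : X ⟶ Spec (.of A)) : A →+* Γ(X, ⊤) :=
  ((Scheme.ΓSpecIso (.of A)).inv ≫ f.appTop).hom

lemma globalSections_comp_specMap {A B : Type u} [CommRing A] [CommRing B] {X : Scheme.{u}}
    (f : X ⟶ Spec (.of B)) (φ : A →+* B) :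
    globalSections (f ≫ Spec.map (CommRingCat.ofHom φ)) = (globalSections f).comp φ := by
  have hnat := Scheme.ΓSpecIso_inv_naturality (CommRingCat.ofHom φ)
  rw [globalSections, Scheme.Hom.comp_appTop, ← Category.assoc, ← hnat, Category.assoc]
  rfl

lemma ker_globalSections_le {A : Type u} [CommRing A] {X Y : Scheme.{u}} (f : X ⟶ Y)
    (g : Y ⟶ Spec (.of A)) :
    RingHom.ker (globalSections g) ≤ RingHom.ker (globalSections (f ≫ g)) := by
  intro a ha
  have hcomp : globalSections (f ≫ g) = f.appTop.hom.comp (globalSections g) := rfl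
  rw [RingHom.mem_ker, hcomp, RingHom.comp_apply, RingHom.mem_ker.mp ha, map_zero]

lemma idealSheaf_le_ker_iff {A : Type u} [CommRing A] {X : Scheme.{u}} {f : X ⟶ Spec (.of A)}
    {I : Ideal A} : idealSheaf I ≤ f.ker ↔ I ≤ RingHom.ker (globalSections f) := by
  have hker : f.ker = idealSheaf (RingHom.ker (globalSections f)) := by
    rw [Scheme.ker_of_isAffine, idealSheaf, globalSections]
    congr 1
    ext a
    simp [Ideal.mem_comap, RingHom.mem_ker]
  rw [hker, idealSheaf_le_idealSheaf_iff]

lemma idealSheaf_le_comap_map {A B C : Type u} [CommRing A] [CommRing B] [CommRing C]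
    {Y : Scheme.{u}} {c : Spec (.of A) ⟶ Y} [IsOpenImmersion c] {d : Spec (.of B) ⟶ Y}
    [QuasiCompact d] {α : A →+* C} {β : B →+* C}
    (h : IsPullback (Spec.map (CommRingCat.ofHom α)) (Spec.map (CommRingCat.ofHom β)) c d)
    {I : Ideal A} {J : Ideal B} (hIJ : I.map α ≤ J.map β) :
    idealSheaf I ≤ ((idealSheaf J).map d).comap c := by
  let p := pullback.fst c ((idealSheaf J).subschemeι ≫ d)
  let q := pullback.snd c ((idealSheaf J).subschemeι ≫ d)
  obtain ⟨t, hα, hβ⟩ := h.exists_lift p (q ≫ (idealSheaf J).subschemeι)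
    (pullback.condition.trans (Category.assoc _ _ _).symm)
  have hJ : J ≤ (RingHom.ker (globalSections t)).comap β := by
    rw [RingHom.comap_ker, ← globalSections_comp_specMap, hβ]
    refine le_trans ?_ (ker_globalSections_le q _)
    rw [← idealSheaf_le_ker_iff, ker_subschemeι]
  have hI : I ≤ RingHom.ker (globalSections p) := by
    rw [← hα, globalSections_comp_specMap, ← RingHom.comap_ker, ← Ideal.map_le_iff_le_comap]
    exact hIJ.trans (Ideal.map_le_iff_le_comap.mpr hJ)
  have hker := comap_ker_of_isOpenImmersion ((idealSheaf J).subschemeι ≫ d) c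
  exact (idealSheaf_le_ker_iff.mpr hI).trans hker.ge

end IdealSheaves

section ZeroScheme

open MvPolynomial HomogeneousLocalization Scheme.IdealSheafData

variable {k : Type*} [Field k]

instance (i : Fin 3) : IsOpenImmersion (chartMap k i) :=
  inferInstanceAs (IsOpenImmersion (Proj.awayι _ _ _ _))

lemma isPullback_chartMap (i j : Fin 3) :
    IsPullback
      (Spec.map (CommRingCat.ofHom (awayMap (Form k) (X_mem k j) (rfl : X i * X j = _))))
      (Spec.map (CommRingCat.ofHom (awayMap (Form k) (X_mem k i) (mul_comm (X i) (X j)))))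
      (chartMap k i) (chartMap k j) :=
  .of_iso (.of_hasPullback _ _)
    (Proj.pullbackAwayιIso (Form k) (X_mem k i) Nat.one_pos (X_mem k j) Nat.one_pos rfl)
    (.refl _) (.refl _) (.refl _) (by simp) (by simp) (by simp [chartMap]) (by simp [chartMap])

lemma map_awayMap_map_toChart_le {n : ℕ} {g : Fin 3 → CoordRing k}
    (hg : ∀ l, (g l).IsHomogeneous n) (i j : Fin 3) :
    ((Ideal.span (Set.range g)).map (toChart i)).map (awayMap (Form k) (X_mem k j) rfl) ≤
      ((Ideal.span (Set.range g)).map (toChart j)).map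
        (awayMap (Form k) (X_mem k i) (mul_comm (X i) (X j))) := by
  simp only [Ideal.map_span, Ideal.span_le]
  rintro _ ⟨_, ⟨_, ⟨l, rfl⟩, rfl⟩, rfl⟩
  rw [SetLike.mem_coe, awayMap_toAway (X_mem k i) (X_mem k j) rfl (mul_comm _ _) (hg l)]
  exact Ideal.mul_mem_left _ _
    (Ideal.subset_span ⟨_, ⟨_, ⟨l, rfl⟩, rfl⟩, rfl⟩)

lemma dehomogenize_eq_toChart (G : Form k 6) (i : Fin 3) :
    dehomogenize G i = toChart i (G : CoordRing k) :=
  (toAway_of_mem (X_mem k i) G.2).symm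

lemma X_dotProduct_gradient_sextic [CharP k 2] (G : Form k 6) :
    (X : Fin 3 → CoordRing k) ⬝ᵥ gradient (G : CoordRing k) = 0 :=
  X_dotProduct_gradient G.2 ((CharP.cast_eq_zero_iff k 2 6).mpr (by norm_num))

lemma zeroSchemeD_eq_iInf [CharP k 2] (G : Form k 6) :
    zeroSchemeD G =
      ⨅ i, (idealSheaf ((jacobianIdeal (G : CoordRing k)).map (toChart i))).map (chartMap k i) := by
  simp only [zeroSchemeD, idealSheaf, dehomogenize_eq_toChart,
    zeroIdeal_D_toChart (X_dotProduct_gradient_sextic G)]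

lemma map_toChart_le_of_zeroSchemeD_le [CharP k 2] {G G' : Form k 6}
    (h : zeroSchemeD G ≤ zeroSchemeD G') (i : Fin 3) :
    (jacobianIdeal (G : CoordRing k)).map (toChart i) ≤
      (jacobianIdeal (G' : CoordRing k)).map (toChart i) := by
  rw [← idealSheaf_le_idealSheaf_iff]
  calc idealSheaf ((jacobianIdeal (G : CoordRing k)).map (toChart i))
      ≤ (zeroSchemeD G).comap (chartMap k i) := by
        rw [zeroSchemeD_eq_iInf, comap_iInf_of_isOpenImmersion]
        exact le_iInf fun j => idealSheaf_le_comap_map (isPullback_chartMap i j)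
          (map_awayMap_map_toChart_le (gradient_isHomogeneous G.2) i j)
    _ ≤ idealSheaf ((jacobianIdeal (G' : CoordRing k)).map (toChart i)) := by
        rw [← le_map_iff_comap_le]
        exact h.trans ((zeroSchemeD_eq_iInf G').trans_le (iInf_le _ i))

end ZeroScheme

section Criteria

open MvPolynomial
open scoped Pointwise

variable {k : Type*} [Field k] [CharP k 2] {G G' : Form k 6}

lemma exists_eq_C_mul_add_sq_iff [PerfectField k] {c : k} :
    (∃ H : Form k 3, (G' : CoordRing k) = C c * (G : CoordRing k) + (H : CoordRing k) ^ 2) ↔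
      gradient (G' : CoordRing k) = (C c : CoordRing k) • gradient (G : CoordRing k) := by
  have := PerfectField.toPerfectRing (K := k) 2
  refine ⟨fun ⟨H, hH⟩ => funext fun l => ?_, fun h => ?_⟩
  · simp only [gradient, Pi.smul_apply, smul_eq_mul]
    rw [hH, map_add, pderiv_C_mul, pderiv_pow, Nat.cast_ofNat, CharTwo.two_eq_zero, zero_mul,
      zero_mul, add_zero]
  · have hhom : ((G' : CoordRing k) - C c * (G : CoordRing k)).IsHomogeneous (2 * 3) :=
      G'.2.sub (by simpa using (isHomogeneous_C _ c).mul G.2)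
    obtain ⟨H, hH, hsq⟩ := exists_eq_pow_of_pderiv_eq_zero 2 hhom fun l => by
      rw [map_sub, pderiv_C_mul]
      exact sub_eq_zero.mpr (congrFun h l)
    exact ⟨⟨H, hH⟩, by rw [← hsq, add_sub_cancel]⟩

lemma zeroSchemeD_eq_of_gradient_eq {c : k} (hc : c ≠ 0)
    (h : gradient (G' : CoordRing k) = (C c : CoordRing k) • gradient (G : CoordRing k)) :
    zeroSchemeD G = zeroSchemeD G' := by
  have hspan : jacobianIdeal (G' : CoordRing k) = jacobianIdeal (G : CoordRing k) := by
    have hrange : Set.range ((C c : CoordRing k) • gradient (G : CoordRing k)) =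
        (C c : CoordRing k) • Set.range (gradient (G : CoordRing k)) :=
      Set.range_smul (C c : CoordRing k) (gradient (G : CoordRing k))
    rw [jacobianIdeal, h, hrange]
    exact Submodule.span_smul_eq_of_isUnit _ _ (hc.isUnit.map C)
  rw [zeroSchemeD_eq_iInf, zeroSchemeD_eq_iInf, hspan]

lemma exists_gradient_eq_of_zeroSchemeD_eq (hG : IsPrimitiveVector (gradient (G : CoordRing k)))
    (h : zeroSchemeD G = zeroSchemeD G') :
    ∃ c : k, c ≠ 0 ∧
      gradient (G' : CoordRing k) = (C c : CoordRing k) • gradient (G : CoordRing k) := by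
  have hmap (i) : (jacobianIdeal (G : CoordRing k)).map (toChart i) =
      (jacobianIdeal (G' : CoordRing k)).map (toChart i) :=
    le_antisymm (map_toChart_le_of_zeroSchemeD_le h.le i)
      (map_toChart_le_of_zeroSchemeD_le h.ge i)
  obtain ⟨c, hc⟩ := exists_eq_C_smul (n := 5) (by norm_num) hG (X_dotProduct_gradient_sextic G)
    (gradient_isHomogeneous G.2) (X_dotProduct_gradient_sextic G') (gradient_isHomogeneous G'.2)
    fun i j => exists_pow_mul_mem_of_toAway_mem (X_mem k i) (jacobianIdeal_isHomogeneous G.2)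
      (gradient_isHomogeneous G'.2 j)
      (hmap i ▸ Ideal.mem_map_of_mem _ (Ideal.subset_span ⟨j, rfl⟩))
  refine ⟨c, ?_, hc⟩
  rintro rfl
  rw [C_0, zero_smul] at hc
  refine hG.ne_zero (funext fun l => ?_)
  have hmem : toChart 0 (gradient (G : CoordRing k) l) ∈
      (jacobianIdeal (G' : CoordRing k)).map (toChart 0) :=
    hmap 0 ▸ Ideal.mem_map_of_mem _ (Ideal.subset_span ⟨l, rfl⟩)
  rw [jacobianIdeal, hc, Ideal.span_eq_bot.mpr (by rintro _ ⟨_, rfl⟩; rfl), Ideal.map_bot,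
    Ideal.mem_bot] at hmem
  exact (toChart_eq_zero_iff (gradient_isHomogeneous G.2 l)).mp hmem

end Criteria

section CoverCharts

open MvPolynomial HomogeneousLocalization

universe u

variable {k : Type u} [Field k] (G : Form k 6)

lemma exists_eq_of_add_of_mul_root (x : CoverRing G) :
    ∃ p q, x = AdjoinRoot.of _ p + AdjoinRoot.of _ q * AdjoinRoot.root _ := by
  obtain ⟨P, rfl⟩ := AdjoinRoot.mk_surjective x
  set f : Polynomial (CoordRing k) := Polynomial.X ^ 2 - Polynomial.C (G : CoordRing k)
  have hmonic : f.Monic := Polynomial.monic_X_pow_sub_C _ two_ne_zero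
  have hdeg : (P %ₘ f).natDegree < 2 :=
    (Polynomial.natDegree_modByMonic_lt P hmonic fun h => by
      simpa [f, Polynomial.natDegree_X_pow_sub_C] using congrArg Polynomial.natDegree h).trans_eq
      Polynomial.natDegree_X_pow_sub_C
  obtain ⟨q, p, hqp⟩ := Polynomial.exists_eq_X_add_C_of_natDegree_le_one (Nat.le_of_lt_succ hdeg)
  have hP : AdjoinRoot.mk f P = AdjoinRoot.mk f (P %ₘ f) := by
    conv_lhs => rw [← Polynomial.modByMonic_add_div P f]
    rw [map_add, map_mul, AdjoinRoot.mk_self, zero_mul, add_zero]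
  refine ⟨p, q, ?_⟩
  rw [hP, hqp, map_add, map_mul, AdjoinRoot.mk_C, AdjoinRoot.mk_C, AdjoinRoot.mk_X, add_comm]

variable {G} in
lemma of_add_of_mul_root_eq_zero {p q : CoordRing k}
    (h : (AdjoinRoot.of _ p + AdjoinRoot.of _ q * AdjoinRoot.root _ : CoverRing G) = 0) :
    p = 0 ∧ q = 0 := by
  have hmk : AdjoinRoot.mk (Polynomial.X ^ 2 - Polynomial.C (G : CoordRing k))
      (Polynomial.C q * Polynomial.X + Polynomial.C p) = 0 := by
    rw [← h, map_add, map_mul, AdjoinRoot.mk_C, AdjoinRoot.mk_C, AdjoinRoot.mk_X, add_comm]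
  have hlin : Polynomial.C q * Polynomial.X + Polynomial.C p = 0 := by
    by_contra h0
    refine (Polynomial.monic_X_pow_sub_C (G : CoordRing k) two_ne_zero).not_dvd_of_degree_lt h0 ?_
      (AdjoinRoot.mk_eq_zero.mp hmk)
    rw [Polynomial.degree_X_pow_sub_C two_pos]
    exact Polynomial.degree_linear_lt
  have hp := congrArg (Polynomial.coeff · 0) hlin
  have hq := congrArg (Polynomial.coeff · 1) hlin
  exact ⟨by simpa using hp, by simpa [Polynomial.coeff_C] using hq⟩

/-- The coordinate ring of the chart `{Xᵢ ≠ 0}` of the double cover. -/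
abbrev CoverChart (i : Fin 3) : Type _ := Away (coverGrading G) (coverCoord G i)

/-- The inclusion of the chart `{Xᵢ ≠ 0}` into the double cover. -/
noncomputable abbrev coverChartMap (i : Fin 3) :
    Spec (.of (CoverChart G i)) ⟶ coverSurface G :=
  Proj.awayι (coverGrading G) (coverCoord G i) (coverCoord_mem G i) Nat.one_pos

/-- Dehomogenization with respect to `Xᵢ` on the cover: `Xᵢ ↦ 1`. -/
noncomputable abbrev toCoverChart (i : Fin 3) : CoverRing G →+* CoverChart G i :=
  toAway (coverCoord_mem G i)

/-- The pullback of functions from a chart of the plane to the double cover. -/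
noncomputable def chartIncl (i : Fin 3) : ChartRing k i →+* CoverChart G i :=
  Away.map (coordIncl G) (X i)

/-- The function `W / Xᵢ³`. -/
noncomputable def rootFun (i : Fin 3) : CoverChart G i :=
  toCoverChart G i (AdjoinRoot.root _)

lemma chartIncl_toChart (i : Fin 3) (a : CoordRing k) :
    chartIncl G i (toChart i a) = toCoverChart G i (AdjoinRoot.of _ a) :=
  map_toAway (X_mem k i) (coordIncl G) (coverCoord_mem G i) a

lemma rootFun_sq (i : Fin 3) : rootFun G i ^ 2 = chartIncl G i (toChart i G) := by
  rw [rootFun, ← map_pow, root_sq, chartIncl_toChart]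

lemma exists_eq_chartIncl_add_mul_rootFun (i : Fin 3) (s : CoverChart G i) :
    ∃ α β, s = chartIncl G i α + chartIncl G i β * rootFun G i := by
  obtain ⟨_, x, _, rfl⟩ := exists_eq_toAway (coverCoord_mem G i) s
  obtain ⟨p, q, rfl⟩ := exists_eq_of_add_of_mul_root G x
  exact ⟨toChart i p, toChart i q, by
    rw [chartIncl_toChart, chartIncl_toChart, rootFun, map_add, map_mul]⟩

variable {G} in
lemma chartIncl_add_mul_rootFun_eq_zero {i : Fin 3} {α β : ChartRing k i}
    (h : chartIncl G i α + chartIncl G i β * rootFun G i = 0) : α = 0 ∧ β = 0 := by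
  obtain ⟨n, a, ha, rfl⟩ := exists_eq_toAway (X_mem k i) α
  obtain ⟨m, b, hb, rfl⟩ := exists_eq_toAway (X_mem k i) β
  -- Multiplying `a` and `b` by powers of `Xᵢ` makes `a + b W` homogeneous.
  set u : CoverRing G :=
    AdjoinRoot.of _ (X i ^ (m + 3) * a) + AdjoinRoot.of _ (X i ^ n * b) * AdjoinRoot.root _
    with hu
  have hmem (d e : ℕ) {c : CoordRing k} (hc : c ∈ Form k e) : X i ^ d * c ∈ Form k (d + e) :=
    SetLike.mul_mem_graded (by simpa using SetLike.pow_mem_graded d (X_mem k i)) hc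
  have hu_mem : u ∈ coverGrading G (m + 3 + n) :=
    add_mem (of_mem G (hmem _ _ ha)) (by
      have := SetLike.mul_mem_graded (of_mem G (hmem n m hb)) (root_mem G)
      rwa [show n + m + 3 = m + 3 + n by ring] at this)
  have hu_zero : toCoverChart G i u = 0 := by
    have hchart (d : ℕ) (c : CoordRing k) : toChart i (X i ^ d * c) = toChart i c := by
      rw [map_mul, map_pow, toAway_self, one_pow, one_mul]
    rw [hu, map_add (toCoverChart G i), map_mul (toCoverChart G i), ← chartIncl_toChart,
      ← chartIncl_toChart, hchart, hchart]
    exact h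
  obtain ⟨N, hN⟩ := exists_pow_mul_mem_of_toAway_mem (coverCoord_mem G i)
    (Ideal.IsHomogeneous.bot _) hu_mem (by rw [hu_zero]; exact zero_mem _)
  have hN' : (AdjoinRoot.of _ (X i ^ N * (X i ^ (m + 3) * a)) +
      AdjoinRoot.of _ (X i ^ N * (X i ^ n * b)) * AdjoinRoot.root _ : CoverRing G) = 0 := by
    rw [map_mul, map_mul (AdjoinRoot.of _) (X i ^ N), mul_assoc, ← mul_add, map_pow]
    exact Ideal.mem_bot.mp hN
  obtain ⟨h2, h3⟩ := of_add_of_mul_root_eq_zero hN'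
  simp only [mul_eq_zero, pow_eq_zero_iff', X_ne_zero, false_and, false_or] at h2 h3
  rw [h2, h3, map_zero]
  exact ⟨rfl, rfl⟩

lemma coverChartMap_comp_coverProj (i : Fin 3) :
    coverChartMap G i ≫ coverProj G =
      Spec.map (CommRingCat.ofHom (chartIncl G i)) ≫ chartMap k i :=
  (coverCharts G).openCover.ι_glueMorphisms (chartProj G) (chartProj_compat G) i

instance (i : Fin 3) : IsNoetherianRing (ChartRing k i) :=
  isNoetherianRing_of_surjective (CoordRing k) _ (toChart i) fun s => ⟨_, toChart_toPoly s⟩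

lemma ringKrullDim_chartRing_le (i : Fin 3) : ringKrullDim (ChartRing k i) + 1 ≤ 3 := by
  have hne : (X i - 1 : CoordRing k) ≠ 0 := fun h => by
    simpa using congrArg (eval (0 : Fin 3 → k)) h
  have hle := ringKrullDim_succ_le_of_surjective (toChart i) (fun s => ⟨_, toChart_toPoly s⟩)
    (mem_nonZeroDivisors_of_ne_zero hne) (by rw [map_sub, map_one, toAway_self, sub_self])
  exact hle.trans (by simp [MvPolynomial.ringKrullDim_of_isNoetherianRing])

lemma ringKrullDim_coverChart_le (i : Fin 3) : ringKrullDim (CoverChart G i) + 1 ≤ 3 := by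
  let ψ : Polynomial (ChartRing k i) →+* CoverChart G i :=
    Polynomial.eval₂RingHom (chartIncl G i) (rootFun G i)
  have hψ : Function.Surjective ψ := fun s => by
    obtain ⟨α, β, rfl⟩ := exists_eq_chartIncl_add_mul_rootFun G i s
    exact ⟨Polynomial.C α + Polynomial.C β * Polynomial.X, by simp [ψ]⟩
  have hmonic : (Polynomial.X ^ 2 - Polynomial.C (toChart i (G : CoordRing k))).Monic :=
    Polynomial.monic_X_pow_sub_C _ two_ne_zero
  have hle := ringKrullDim_succ_le_of_surjective ψ hψ hmonic.mem_nonZeroDivisors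
    (by simp [ψ, rootFun_sq])
  rw [Polynomial.ringKrullDim_of_isNoetherianRing] at hle
  exact hle.trans (ringKrullDim_chartRing_le i)

end CoverCharts

section SquareZeroExtensions

open TrivSqZeroExt

variable {k V : Type*} [Field k] [AddCommGroup V] [Module k V] [Module kᵐᵒᵖ V]

lemma snd_mem_span_of_mem_span {R : Type*} [CommRing R] (f : R →+* TrivSqZeroExt k V) {S : Set R}
    (hS : ∀ s ∈ S, (f s).fst = 0) {y : R} (hy : y ∈ Ideal.span S) :
    (f y).fst = 0 ∧ (f y).snd ∈ Submodule.span k ((fun s => (f s).snd) '' S) := by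
  induction hy using Submodule.span_induction with
  | mem y hy => exact ⟨hS y hy, Submodule.subset_span ⟨y, hy, rfl⟩⟩
  | zero => simp
  | add y z _ _ hy hz => simpa [hy.1, hz.1] using add_mem hy.2 hz.2
  | smul c y _ hy =>
    refine ⟨by simp [hy.1], ?_⟩
    rw [smul_eq_mul, map_mul, snd_mul, hy.1]
    simpa using Submodule.smul_mem _ _ hy.2

variable [IsCentralScalar k V]

instance : IsLocalRing (TrivSqZeroExt k V) :=
  have : IsLocalHom (fstHom k k V).toRingHom := ⟨fun _ h => isUnit_iff_isUnit_fst.mpr h⟩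
  RingHom.domain_isLocalRing (fstHom k k V).toRingHom

lemma mem_maximalIdeal_trivSqZeroExt {x : TrivSqZeroExt k V} :
    x ∈ IsLocalRing.maximalIdeal (TrivSqZeroExt k V) ↔ x.fst = 0 := by
  rw [IsLocalRing.mem_maximalIdeal, mem_nonunits_iff, isUnit_iff_isUnit_fst, isUnit_iff_ne_zero,
    not_not]

lemma finrank_le_spanFinrank_maximalIdeal {R : Type*} [CommRing R] [IsLocalRing R]
    [IsNoetherianRing R] (f : R →+* TrivSqZeroExt k V) (hf : Function.Surjective f) :
    Module.finrank k V ≤ (IsLocalRing.maximalIdeal R).spanFinrank := by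
  classical
  have hloc : IsLocalHom f := .of_surjective f hf
  have hmem (x : R) : x ∈ IsLocalRing.maximalIdeal R ↔ (f x).fst = 0 := by
    rw [← mem_maximalIdeal_trivSqZeroExt]
    exact (map_mem_nonunits_iff f x).symm
  obtain ⟨S, hcard, hspan⟩ := Submodule.FG.exists_span_finset_card_eq_spanFinrank
    (IsNoetherian.noetherian (IsLocalRing.maximalIdeal R))
  have htop : Submodule.span k ((S.image fun s => (f s).snd : Finset V) : Set V) = ⊤ := by
    refine top_le_iff.mp fun v _ => ?_
    obtain ⟨x, hx⟩ := hf (inr v)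
    have hxS : x ∈ Ideal.span (S : Set R) :=
      hspan.ge ((hmem x).mpr (by rw [hx, fst_inr]))
    have hv := (snd_mem_span_of_mem_span f
      (fun s hs => (hmem s).mp (hspan.le (Submodule.subset_span hs))) hxS).2
    rwa [hx, snd_inr, ← Finset.coe_image] at hv
  have hle := finrank_span_le_card (R := k) ((S.image fun s => (f s).snd : Finset V) : Set V)
  rw [htop, finrank_top, Finset.toFinset_coe] at hle
  exact hcard ▸ hle.trans Finset.card_image_le

lemma surjective_of_inl_mem_range_of_inr_mem_range {R ι : Type*} [Ring R] [Finite ι]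
    [DecidableEq ι] (f : R →+* TrivSqZeroExt k (ι → k)) (hinl : ∀ c, inl c ∈ f.range)
    (hinr : ∀ j, inr (Pi.single j 1) ∈ f.range) : Function.Surjective f := by
  have := Fintype.ofFinite ι
  intro x
  have hx : x = inl x.fst + ∑ j, inl (x.snd j) * inr (Pi.single j 1) := by
    ext t
    · simp [fst_sum]
    · simp [snd_sum, Finset.sum_apply, Pi.single_apply]
  rw [hx]
  exact add_mem (hinl _) (sum_mem fun j _ => mul_mem (hinl _) (hinr j))

open MvPolynomial in
lemma aeval_inl_add_inr {σ : Type*} [Fintype σ] (a : σ → k) (v : σ → V) (F : MvPolynomial σ k) :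
    aeval (fun j => (inl (a j) + inr (v j) : TrivSqZeroExt k V)) F =
      inl (eval a F) + inr (∑ j, eval a (pderiv j F) • v j) := by
  classical
  induction F using MvPolynomial.induction_on with
  | C c => simp [algebraMap_eq_inl]
  | add p q hp hq =>
    rw [map_add, hp, hq]
    ext <;> simp [add_smul, Finset.sum_add_distrib]
  | mul_X p l hp =>
    rw [map_mul, hp, aeval_X]
    have hsum : ∑ j, eval a (p * pderiv j (X l)) • v j = eval a p • v l := by
      rw [Finset.sum_eq_single l (fun j _ hj => by simp [pderiv_X_of_ne hj.symm]) (by simp)]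
      simp
    ext
    · simp
    · simp only [snd_mul, fst_add, snd_add, fst_inl, fst_inr, snd_inl, snd_inr, add_zero, zero_add,
        pderiv_mul, map_add, add_smul, Finset.sum_add_distrib, op_smul_eq_smul, hsum]
      simp [Finset.smul_sum, smul_smul, mul_comm, add_comm]

end SquareZeroExtensions

section TangentSpaces

universe u

variable {X : Scheme.{u}} {R : CommRingCat.{u}}

lemma stalkClosedPointTo_surjective {S : CommRingCat.{u}} [IsLocalRing S] (φ : R ⟶ S)
    (hφ : Function.Surjective φ.hom) (ι : Spec R ⟶ X) [IsOpenImmersion ι] :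
    Function.Surjective (Scheme.stalkClosedPointTo (Spec.map φ ≫ ι)).hom := by
  rw [Scheme.stalkClosedPointTo_comp]
  have hgerm : Function.Surjective
      ((Spec R).presheaf.germ ⊤ _ trivial ≫ Scheme.stalkClosedPointTo (Spec.map φ)).hom := by
    rw [Scheme.germ_stalkClosedPointTo_Spec]
    exact hφ.comp (ConcreteCategory.bijective_of_isIso (Scheme.ΓSpecIso R).hom).2
  have hspec : Function.Surjective (Scheme.stalkClosedPointTo (Spec.map φ)).hom :=
    Function.Surjective.of_comp hgerm
  exact hspec.comp (ConcreteCategory.bijective_of_isIso (Scheme.Hom.stalkMap ι _)).2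

lemma ringKrullDim_stalk_le (ι : Spec R ⟶ X) [IsOpenImmersion ι] (z : Spec R) :
    ringKrullDim (X.presheaf.stalk (ι z)) ≤ ringKrullDim R := by
  rw [ringKrullDim_stalk_eq_coheight, coheight_eq_of_isOpenImmersion, ← idealHeight_eq_coheight]
  have : z.asIdeal.IsPrime := PrimeSpectrum.isPrime z
  exact Ideal.height_le_ringKrullDim_of_isPrime

lemma not_isRegularLocalRing_stalk {k V : Type u} [Field k] [AddCommGroup V] [Module k V]
    [Module kᵐᵒᵖ V] [IsCentralScalar k V] (φ : R ⟶ .of (TrivSqZeroExt k V))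
    (hφ : Function.Surjective φ.hom) (ι : Spec R ⟶ X) [IsOpenImmersion ι]
    (hR : ringKrullDim R + 1 ≤ Module.finrank k V) :
    ¬ IsRegularLocalRing
      (X.presheaf.stalk ((Spec.map φ ≫ ι) (IsLocalRing.closedPoint (TrivSqZeroExt k V)))) := by
  intro hreg
  have := hreg.toIsNoetherian
  have hge := finrank_le_spanFinrank_maximalIdeal (k := k)
    (Scheme.stalkClosedPointTo (Spec.map φ ≫ ι)).hom (stalkClosedPointTo_surjective φ hφ ι)
  have hle := (add_le_add_left (hreg.spanFinrank_maximalIdeal.trans_le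
    (ringKrullDim_stalk_le ι _)) 1).trans hR
  exact absurd hge (not_le.mpr (Nat.lt_of_succ_le (by exact_mod_cast hle)))

end TangentSpaces

section CriticalPoints

open MvPolynomial TrivSqZeroExt

universe u

/-- A point of the chart `{Xᵢ ≠ 0}` of the double cover at which `dG` vanishes, normalized by
`Xᵢ = 1`. -/
structure CriticalPoint {k : Type u} [Field k] (G : Form k 6) (i : Fin 3) where
  point : Fin 3 → k
  root : k
  point_apply_self : point i = 1
  root_pow_two : root ^ 2 = eval point (G : CoordRing k)
  eval_gradient : ∀ j, eval point (gradient (G : CoordRing k) j) = 0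

namespace CriticalPoint

variable {k : Type u} [Field k] {G : Form k 6} {i : Fin 3}

/-- The universal first-order deformation of the coordinates of a point with `Xᵢ = 1` fixed; the
`i`-th direction is left for the deformation of `W`. -/
noncomputable def deformation (P : CriticalPoint G i) (j : Fin 3) : TrivSqZeroExt k (Fin 3 → k) :=
  inl (P.point j) + inr (if j = i then 0 else Pi.single j 1)

lemma aeval_deformation_eq_inl (P : CriticalPoint G i) :
    aeval P.deformation (G : CoordRing k) = inl (eval P.point (G : CoordRing k)) := by
  refine (aeval_inl_add_inr P.point _ _).trans ?_
  have hgrad (j) : eval P.point (pderiv j (G : CoordRing k)) = 0 := P.eval_gradient j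
  simp [hgrad]

variable [CharP k 2] (P : CriticalPoint G i)

/-- The universal first-order deformation of a critical point: since `dG` vanishes and `(W²)' = 0`,
the tangent space of the cover is three-dimensional. -/
noncomputable def tangentHom : CoverRing G →+* TrivSqZeroExt k (Fin 3 → k) :=
  AdjoinRoot.lift (aeval P.deformation).toRingHom (inl P.root + inr (Pi.single i 1)) (by
    have hsq : (inl P.root + inr (Pi.single i 1) : TrivSqZeroExt k (Fin 3 → k)) ^ 2 =
        inl (eval P.point (G : CoordRing k)) := by
      rw [← P.root_pow_two]
      ext <;> simp [sq, ← two_smul k, CharTwo.two_eq_zero]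
    rw [Polynomial.eval₂_sub, Polynomial.eval₂_pow, Polynomial.eval₂_X, Polynomial.eval₂_C, hsq]
    exact sub_eq_zero.mpr P.aeval_deformation_eq_inl.symm)

lemma tangentHom_of (F : CoordRing k) :
    P.tangentHom (AdjoinRoot.of _ F) = aeval P.deformation F :=
  AdjoinRoot.lift_of _

lemma tangentHom_root : P.tangentHom (AdjoinRoot.root _) = inl P.root + inr (Pi.single i 1) :=
  AdjoinRoot.lift_root _

lemma tangentHom_coverCoord : P.tangentHom (coverCoord G i) = 1 :=
  (P.tangentHom_of (X i)).trans (by simp [deformation, P.point_apply_self])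

lemma tangentHom_surjective : Function.Surjective P.tangentHom := by
  have hinl (c : k) : inl c ∈ P.tangentHom.range :=
    ⟨_, (P.tangentHom_of (C c)).trans (aeval_C _ _)⟩
  refine surjective_of_inl_mem_range_of_inr_mem_range _ hinl fun j => ?_
  rcases eq_or_ne j i with rfl | hj
  · have hroot : inl P.root + inr (Pi.single j 1) ∈ P.tangentHom.range := ⟨_, P.tangentHom_root⟩
    simpa using sub_mem hroot (hinl P.root)
  · have hX : inl (P.point j) + inr (Pi.single j 1) ∈ P.tangentHom.range :=
      ⟨_, (P.tangentHom_of (X j)).trans (by simp [deformation, hj])⟩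
    simpa using sub_mem hX (hinl (P.point j))

/-- The universal first-order deformation of a critical point, on the coordinate ring of the
chart. -/
noncomputable def chartTangentHom : CoverChart G i →+* TrivSqZeroExt k (Fin 3 → k) :=
  awayEval (coverGrading G) P.tangentHom P.tangentHom_coverCoord

lemma chartTangentHom_toCoverChart (x : CoverRing G) :
    P.chartTangentHom (toCoverChart G i x) = P.tangentHom x :=
  awayEval_toAway _ _ _ _

lemma chartTangentHom_surjective : Function.Surjective P.chartTangentHom := fun t =>
  have ⟨x, hx⟩ := P.tangentHom_surjective t
  ⟨_, (P.chartTangentHom_toCoverChart x).trans hx⟩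

/-- The point of the double cover given by a critical point. -/
noncomputable def toCover : coverSurface G :=
  (Spec.map (CommRingCat.ofHom P.chartTangentHom) ≫ coverChartMap G i)
    (IsLocalRing.closedPoint (TrivSqZeroExt k (Fin 3 → k)))

lemma toCover_mem_singularPoints : P.toCover ∈ singularPoints (coverSurface G) :=
  not_isRegularLocalRing_stalk (CommRingCat.ofHom P.chartTangentHom) P.chartTangentHom_surjective
    (coverChartMap G i) (by simpa using ringKrullDim_coverChart_le G i)

variable {P} in
lemma point_eq_of_toCover_eq {Q : CriticalPoint G i} (h : P.toCover = Q.toCover) :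
    P.point = Q.point := by
  have hmem (R : CriticalPoint G i) (F : CoordRing k) :
      toCoverChart G i (AdjoinRoot.of _ F) ∈ PrimeSpectrum.asIdeal
        (Spec.map (CommRingCat.ofHom R.chartTangentHom)
          (IsLocalRing.closedPoint (TrivSqZeroExt k (Fin 3 → k)))) ↔ eval R.point F = 0 := by
    change R.chartTangentHom _ ∈ IsLocalRing.maximalIdeal _ ↔ _
    rw [mem_maximalIdeal_trivSqZeroExt, chartTangentHom_toCoverChart, tangentHom_of]
    refine Eq.congr_left ((congrArg fst (aeval_inl_add_inr R.point _ F)).trans ?_)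
    simp
  have hspec := (coverChartMap G i).isOpenEmbedding.injective h
  funext j
  have hj := (hmem Q (X j - C (P.point j))).mp (hspec ▸ (hmem P _).mpr (by simp))
  exact (sub_eq_zero.mp (by simpa using hj)).symm

end CriticalPoint

lemma isPrimitiveVector_gradient_of_finite_singularPoints {k : Type u} [Field k] [IsAlgClosed k]
    [CharP k 2] {G : Form k 6} (hfin : (singularPoints (coverSurface G)).Finite) :
    IsPrimitiveVector (gradient (G : CoordRing k)) := by
  by_contra hG
  obtain ⟨i, hinf⟩ := exists_infinite_common_zeros (gradient_isHomogeneous G.2) hG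
  choose r hr using fun c : k => IsAlgClosed.exists_pow_nat_eq c two_pos
  have := hinf.to_subtype
  let P (a : {a : Fin 3 → k | a i = 1 ∧ ∀ j, eval a (gradient (G : CoordRing k) j) = 0}) :
      CriticalPoint G i := ⟨a, r (eval a.1 (G : CoordRing k)), a.2.1, hr _, a.2.2⟩
  refine Set.infinite_of_injective_forall_mem (f := fun a => (P a).toCover) (fun a b hab => ?_)
    (fun a => (P a).toCover_mem_singularPoints) hfin
  exact Subtype.ext (CriticalPoint.point_eq_of_toCover_eq hab)

end CriticalPoints

lemma add_sq_of_charTwo_ringHom {R S : Type*} [CommRing R] [CharP R 2] [CommRing S] (f : R →+* S)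
    (x y : S) : (x + y) ^ 2 = x ^ 2 + y ^ 2 := by
  have htwo : (2 : S) = 0 := by rw [← map_ofNat f 2, CharTwo.two_eq_zero, map_zero]
  rw [add_sq, htwo, zero_mul, zero_mul, add_zero]

section ProjMap

open HomogeneousLocalization HomogeneousIdeal

universe u

variable {A B σ τ : Type u} [CommRing A] [SetLike σ A] [AddSubgroupClass σ A]
  [CommRing B] [SetLike τ B] [AddSubgroupClass τ B]
  {𝒜 : ℕ → σ} {ℬ : ℕ → τ} [GradedRing 𝒜] [GradedRing ℬ]

lemma irrelevant_le_map_of_rightInverse (f : 𝒜 →+*ᵍ ℬ) (g : ℬ →+*ᵍ 𝒜)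
    (h : Function.RightInverse g f) :
    HomogeneousIdeal.irrelevant ℬ ≤ (HomogeneousIdeal.irrelevant 𝒜).map f := by
  refine toIdeal_le_toIdeal_iff.mp ((toIdeal_irrelevant_le _).mpr fun n hn x hx => ?_)
  rw [← h x]
  exact Ideal.mem_map_of_mem f (mem_irrelevant_of_mem 𝒜 hn (g.map_mem hx))

lemma projMap_comp_eq_id (f : 𝒜 →+*ᵍ ℬ) (g : ℬ →+*ᵍ 𝒜) (hf hg)
    (h : Function.LeftInverse g f) : Proj.map g hg ≫ Proj.map f hf = 𝟙 (Proj 𝒜) := by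
  rw [← Proj.map_comp]
  have hid : g.comp f = GradedRingHom.id 𝒜 := GradedRingHom.ext h
  simp only [hid, Proj.map_id]

/-- The isomorphism of projective spectra induced by an isomorphism of graded rings. -/
noncomputable def projIso (f : 𝒜 →+*ᵍ ℬ) (g : ℬ →+*ᵍ 𝒜)
    (hfg : Function.RightInverse g f) (hgf : Function.LeftInverse g f) : Proj ℬ ≅ Proj 𝒜 where
  hom := Proj.map f (irrelevant_le_map_of_rightInverse f g hfg)
  inv := Proj.map g (irrelevant_le_map_of_rightInverse g f hgf)
  hom_inv_id := projMap_comp_eq_id g f _ _ hfg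
  inv_hom_id := projMap_comp_eq_id f g _ _ hgf

lemma exists_awayι_comp_projMap (f : 𝒜 →+*ᵍ ℬ) (hf) {s : A} {t : B} (h : f s = t)
    (hs : s ∈ 𝒜 1) (ht : t ∈ ℬ 1) :
    ∃ ρ : Away 𝒜 s →+* Away ℬ t, (∀ a, ρ (toAway hs a) = toAway ht (f a)) ∧
      Proj.awayι ℬ t ht Nat.one_pos ≫ Proj.map f hf =
        Spec.map (CommRingCat.ofHom ρ) ≫ Proj.awayι 𝒜 s hs Nat.one_pos := by
  subst h
  exact ⟨Away.map f s, map_toAway hs f ht, Proj.awayι_comp_map f hf Nat.one_pos s hs⟩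

end ProjMap

section CoverMaps

open MvPolynomial HomogeneousLocalization

universe u

variable {k : Type u} [Field k] {G G' : Form k 6}

lemma eval₂_X_sq_sub_C_eq_zero {r : CoverRing G}
    (hsq : r ^ 2 = AdjoinRoot.of _ (G' : CoordRing k)) :
    (Polynomial.X ^ 2 - Polynomial.C (G' : CoordRing k)).eval₂
      (AdjoinRoot.of (Polynomial.X ^ 2 - Polynomial.C (G : CoordRing k))) r = 0 := by
  simp [hsq]

/-- The homomorphism `W ↦ r` of homogeneous coordinate rings over `k[X₀, X₁, X₂]` given by an
element `r` of degree `3` with `r² = G'`. -/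
noncomputable def coverLift {r : CoverRing G} (hr : r ∈ coverGrading G 3)
    (hsq : r ^ 2 = AdjoinRoot.of _ (G' : CoordRing k)) :
    coverGrading G' →+*ᵍ coverGrading G where
  __ := AdjoinRoot.lift _ r (eval₂_X_sq_sub_C_eq_zero hsq)
  map_mem {n x} hx := by
    change AdjoinRoot.lift _ r (eval₂_X_sq_sub_C_eq_zero hsq) x ∈ coverGrading G n
    induction hx using Submodule.span_induction with
    | zero => rw [map_zero]; exact zero_mem _
    | add x y _ _ hx hy => rw [map_add]; exact add_mem hx hy
    | smul c x _ hx =>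
      rw [Algebra.smul_def, map_mul, show algebraMap k (CoverRing G') c = AdjoinRoot.of _ (C c)
        from rfl, AdjoinRoot.lift_of,
        show AdjoinRoot.of _ (C c) = algebraMap k (CoverRing G) c from rfl, ← Algebra.smul_def]
      exact Submodule.smul_mem _ _ hx
    | mem x hx =>
      obtain ⟨m, j, rfl, a, ha, rfl⟩ := hx
      rw [map_mul, map_pow, AdjoinRoot.lift_of, AdjoinRoot.lift_root, mul_comm 3 j]
      exact SetLike.mul_mem_graded (of_mem G ha) (SetLike.pow_mem_graded j hr)

section

variable {r : CoverRing G} (hr : r ∈ coverGrading G 3)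
  (hsq : r ^ 2 = AdjoinRoot.of _ (G' : CoordRing k))

lemma coverLift_of (a : CoordRing k) :
    coverLift hr hsq (AdjoinRoot.of _ a) = AdjoinRoot.of _ a :=
  AdjoinRoot.lift_of (eval₂_X_sq_sub_C_eq_zero hsq)

lemma coverLift_root : coverLift hr hsq (AdjoinRoot.root _) = r :=
  AdjoinRoot.lift_root (eval₂_X_sq_sub_C_eq_zero hsq)

lemma leftInverse_coverLift {r' : CoverRing G'} (hr' : r' ∈ coverGrading G' 3)
    (hsq' : r' ^ 2 = AdjoinRoot.of _ (G : CoordRing k))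
    (h : coverLift hr' hsq' r = AdjoinRoot.root _) :
    Function.LeftInverse (coverLift hr' hsq') (coverLift hr hsq) := by
  have hid : (coverLift hr' hsq').toRingHom.comp (coverLift hr hsq).toRingHom =
      RingHom.id (CoverRing G') := by
    refine AdjoinRoot.ringHom_ext (RingHom.ext fun a => ?_) ?_
    · change coverLift hr' hsq' (coverLift hr hsq (AdjoinRoot.of _ a)) = AdjoinRoot.of _ a
      rw [coverLift_of, coverLift_of]
    · change coverLift hr' hsq' (coverLift hr hsq (AdjoinRoot.root _)) = AdjoinRoot.root _
      rw [coverLift_root, h]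
  exact RingHom.congr_fun hid

end

lemma projMap_comp_coverProj (Φ : coverGrading G' →+*ᵍ coverGrading G) (hΦ)
    (h : ∀ a, Φ (AdjoinRoot.of _ a) = AdjoinRoot.of _ a) :
    Proj.map Φ hΦ ≫ coverProj G' = coverProj G := by
  refine (coverCharts G).openCover.hom_ext _ _ fun (i : Fin 3) => ?_
  change coverChartMap G i ≫ Proj.map Φ hΦ ≫ coverProj G' = coverChartMap G i ≫ coverProj G
  obtain ⟨ρ, hρ, hcomp⟩ := exists_awayι_comp_projMap Φ hΦ (s := coverCoord G' i)
    (t := coverCoord G i) (h (X i)) (coverCoord_mem G' i) (coverCoord_mem G i)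
  have hchart : ρ.comp (chartIncl G' i) = chartIncl G i := RingHom.ext fun s => by
    obtain ⟨_, a, _, rfl⟩ := exists_eq_toAway (X_mem k i) s
    rw [RingHom.comp_apply, chartIncl_toChart, chartIncl_toChart, hρ, h]
  rw [← Category.assoc, hcomp, Category.assoc, coverChartMap_comp_coverProj,
    coverChartMap_comp_coverProj, ← Category.assoc, ← Spec.map_comp, ← CommRingCat.ofHom_comp,
    hchart]

lemma of_C_mul_root_add_mem (d : k) (H : Form k 3) :
    (AdjoinRoot.of _ (C d) * AdjoinRoot.root _ + AdjoinRoot.of _ (H : CoordRing k) :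
      CoverRing G) ∈ coverGrading G 3 := by
  have hC := of_mem G ((mem_homogeneousSubmodule _ _).mpr (isHomogeneous_C (Fin 3) d))
  exact add_mem (by simpa using SetLike.mul_mem_graded hC (root_mem G)) (of_mem G H.2)

variable [CharP k 2]

lemma sq_of_C_mul_root_add {d : k} {H : Form k 3}
    (h : (G' : CoordRing k) = C (d ^ 2) * (G : CoordRing k) + (H : CoordRing k) ^ 2) :
    (AdjoinRoot.of _ (C d) * AdjoinRoot.root _ + AdjoinRoot.of _ (H : CoordRing k) :
      CoverRing G) ^ 2 = AdjoinRoot.of _ (G' : CoordRing k) := by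
  rw [add_sq_of_charTwo_ringHom (AdjoinRoot.of _), mul_pow, root_sq, h, map_add, map_mul, map_pow,
    map_pow, map_pow]

lemma leftInverse_coverLift_C_mul_root_add {d e : k} {H K : Form k 3}
    (h : (G' : CoordRing k) = C (d ^ 2) * (G : CoordRing k) + (H : CoordRing k) ^ 2)
    (h' : (G : CoordRing k) = C (e ^ 2) * (G' : CoordRing k) + (K : CoordRing k) ^ 2)
    (hde : d * e = 1) (hHK : C d * (K : CoordRing k) + (H : CoordRing k) = 0) :
    Function.LeftInverse
      (coverLift (of_C_mul_root_add_mem e K) (sq_of_C_mul_root_add h'))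
      (coverLift (of_C_mul_root_add_mem d H) (sq_of_C_mul_root_add h)) := by
  refine leftInverse_coverLift _ _ _ _ ?_
  rw [map_add, map_mul, coverLift_of, coverLift_of, coverLift_root, mul_add, ← mul_assoc,
    ← map_mul, ← C_mul, hde, add_assoc, ← map_mul, ← map_add, hHK, C_1, map_one, map_zero,
    one_mul, add_zero]

lemma nonempty_iso_of_eq_add_sq [PerfectField k] {c : k} (hc : c ≠ 0) {H : Form k 3}
    (h : (G' : CoordRing k) = C c * (G : CoordRing k) + (H : CoordRing k) ^ 2) :
    Nonempty (Over.mk (coverProj G) ≅ Over.mk (coverProj G')) := by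
  have := PerfectField.toPerfectRing (K := k) 2
  obtain ⟨d, rfl⟩ : ∃ d, d ^ 2 = c := surjective_frobenius k 2 c
  have hd : d ≠ 0 := fun h0 => hc (by rw [h0, zero_pow two_ne_zero])
  have hCd : (C d⁻¹ : CoordRing k) * C d = 1 := by rw [← C_mul, inv_mul_cancel₀ hd, C_1]
  have hK : ((d⁻¹ • H : Form k 3) : CoordRing k) = C d⁻¹ * (H : CoordRing k) := smul_eq_C_mul _ _
  have h' : (G : CoordRing k) =
      C (d⁻¹ ^ 2) * (G' : CoordRing k) + ((d⁻¹ • H : Form k 3) : CoordRing k) ^ 2 := by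
    rw [hK, h, mul_pow, mul_add, add_assoc, C_pow, CharTwo.add_self_eq_zero, add_zero, C_pow,
      ← mul_assoc, ← mul_pow, hCd, one_pow, one_mul]
  have hinv := leftInverse_coverLift_C_mul_root_add h h' (mul_inv_cancel₀ hd) (by
    rw [hK, ← mul_assoc, mul_comm (C d), hCd, one_mul, CharTwo.add_self_eq_zero])
  have hinv' := leftInverse_coverLift_C_mul_root_add h' h (inv_mul_cancel₀ hd) (by
    rw [hK, CharTwo.add_self_eq_zero])
  exact ⟨Over.isoMk (projIso _ _ hinv' hinv) (projMap_comp_coverProj _ _ (coverLift_of _ _))⟩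

end CoverMaps

section CoverIso

open MvPolynomial HomogeneousLocalization

universe u

variable {k : Type u} [Field k] {G G' : Form k 6}

lemma chartIncl_isLocalizationElem (i j : Fin 3) :
    chartIncl G j (Away.isLocalizationElem (X_mem k j) (X_mem k i)) =
      Away.isLocalizationElem (coverCoord_mem G j) (coverCoord_mem G i) := by
  rw [chartIncl, Away.isLocalizationElem, Away.map_mk, HomogeneousLocalization.ext_iff_val,
    Away.val_mk, Away.val_mk, map_pow]

lemma mem_basicOpen_coverCoord {i : Fin 3} {y : coverSurface G}
    (h : coverProj G y ∈ Proj.basicOpen (Form k) (X i)) :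
    y ∈ Proj.basicOpen (coverGrading G) (coverCoord G i) := by
  obtain ⟨j, z, rfl⟩ : ∃ j, ∃ z : Spec (.of (CoverChart G j)), coverChartMap G j z = y := by
    obtain ⟨j, hj⟩ := TopologicalSpace.Opens.mem_iSup.mp
      ((iSup_basicOpen_coverCoord G).ge (Set.mem_univ y))
    rw [← Proj.opensRange_awayι (coverGrading G) _ (coverCoord_mem G j) Nat.one_pos] at hj
    exact ⟨j, hj⟩
  rw [← Scheme.Hom.comp_apply, coverChartMap_comp_coverProj, Scheme.Hom.comp_apply] at h
  have hz := (Proj.awayι_preimage_basicOpen (Form k) (X_mem k j) Nat.one_pos (X_mem k i)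
    Nat.one_pos).le h
  change z ∈ coverChartMap G j ⁻¹ᵁ Proj.basicOpen (coverGrading G) (coverCoord G i)
  rw [Proj.awayι_preimage_basicOpen (coverGrading G) (coverCoord_mem G j) Nat.one_pos
    (coverCoord_mem G i) Nat.one_pos, ← chartIncl_isLocalizationElem]
  exact hz

lemma range_coverChartMap_comp_subset {f : coverSurface G ⟶ coverSurface G'}
    (hf : f ≫ coverProj G' = coverProj G) (i : Fin 3) :
    Set.range (coverChartMap G i ≫ f) ⊆ Set.range (coverChartMap G' i) := by
  rintro _ ⟨z, rfl⟩
  change _ ∈ (coverChartMap G' i).opensRange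
  rw [Proj.opensRange_awayι]
  refine mem_basicOpen_coverCoord ?_
  rw [← Scheme.Hom.comp_apply, Category.assoc, hf, coverChartMap_comp_coverProj,
    Scheme.Hom.comp_apply, ← Proj.opensRange_awayι (Form k) _ (X_mem k i) Nat.one_pos]
  exact ⟨_, rfl⟩

lemma exists_coverChartHom {f : coverSurface G ⟶ coverSurface G'}
    (hf : f ≫ coverProj G' = coverProj G) (i : Fin 3) :
    ∃ θ : CoverChart G' i →+* CoverChart G i,
      Spec.map (CommRingCat.ofHom θ) ≫ coverChartMap G' i = coverChartMap G i ≫ f := by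
  refine ⟨(Spec.preimage (IsOpenImmersion.lift _ _ (range_coverChartMap_comp_subset hf i))).hom, ?_⟩
  rw [CommRingCat.ofHom_hom, Spec.map_preimage, IsOpenImmersion.lift_fac]

lemma coverChartHom_comp_chartIncl {f : coverSurface G ⟶ coverSurface G'}
    (hf : f ≫ coverProj G' = coverProj G) {i : Fin 3} {θ : CoverChart G' i →+* CoverChart G i}
    (hθ : Spec.map (CommRingCat.ofHom θ) ≫ coverChartMap G' i = coverChartMap G i ≫ f) :
    θ.comp (chartIncl G' i) = chartIncl G i := by
  have hSpec : Spec.map (CommRingCat.ofHom (θ.comp (chartIncl G' i))) =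
      Spec.map (CommRingCat.ofHom (chartIncl G i)) := by
    rw [← cancel_mono (chartMap k i), ← coverChartMap_comp_coverProj, CommRingCat.ofHom_comp,
      Spec.map_comp, Category.assoc, ← coverChartMap_comp_coverProj, reassoc_of% hθ, hf]
  exact congrArg CommRingCat.Hom.hom (Spec.map_injective hSpec)

lemma coverChartHom_comp_eq_id {f : coverSurface G ⟶ coverSurface G'}
    {g : coverSurface G' ⟶ coverSurface G} (hfg : f ≫ g = 𝟙 _) {i : Fin 3}
    {θ : CoverChart G' i →+* CoverChart G i} {θ' : CoverChart G i →+* CoverChart G' i}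
    (hθ : Spec.map (CommRingCat.ofHom θ) ≫ coverChartMap G' i = coverChartMap G i ≫ f)
    (hθ' : Spec.map (CommRingCat.ofHom θ') ≫ coverChartMap G i = coverChartMap G' i ≫ g) :
    θ.comp θ' = RingHom.id _ := by
  have hSpec : Spec.map (CommRingCat.ofHom (θ.comp θ')) =
      Spec.map (CommRingCat.ofHom (RingHom.id (CoverChart G i))) := by
    rw [← cancel_mono (coverChartMap G i), CommRingCat.ofHom_comp, Spec.map_comp, Category.assoc,
      hθ', reassoc_of% hθ, hfg, CommRingCat.ofHom_id, Spec.map_id, Category.comp_id,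
      Category.id_comp]
  exact congrArg CommRingCat.Hom.hom (Spec.map_injective hSpec)

lemma chartIncl_injective (G : Form k 6) (i : Fin 3) : Function.Injective (chartIncl G i) :=
  (injective_iff_map_eq_zero _).mpr fun α hα => (chartIncl_add_mul_rootFun_eq_zero (G := G)
    (β := 0) (by rw [hα, map_zero, zero_mul, add_zero])).1

lemma isUnit_of_coverChartHom_comp_eq_id {i : Fin 3} {θ : CoverChart G' i →+* CoverChart G i}
    {θ' : CoverChart G i →+* CoverChart G' i} (hθ : θ.comp (chartIncl G' i) = chartIncl G i)
    (hθθ' : θ.comp θ' = RingHom.id _) {α β : ChartRing k i}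
    (hαβ : θ (rootFun G' i) = chartIncl G i α + chartIncl G i β * rootFun G i) : IsUnit β := by
  obtain ⟨γ, δ, hγδ⟩ := exists_eq_chartIncl_add_mul_rootFun G' i (θ' (rootFun G i))
  have hι (s : ChartRing k i) : θ (chartIncl G' i s) = chartIncl G i s := RingHom.congr_fun hθ s
  have hroot := RingHom.congr_fun hθθ' (rootFun G i)
  rw [RingHom.comp_apply, hγδ, map_add, map_mul, hι, hι, hαβ, RingHom.id_apply] at hroot
  have hzero : chartIncl G i (γ + δ * α) + chartIncl G i (β * δ - 1) * rootFun G i = 0 := by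
    rw [map_add, map_sub, map_mul, map_mul, map_one]
    linear_combination hroot
  exact IsUnit.of_mul_eq_one δ (sub_eq_zero.mp (chartIncl_add_mul_rootFun_eq_zero hzero).2)

lemma eq_zero_of_X_dotProduct_eq_zero {i : Fin 3} {v : Fin 3 → CoordRing k}
    (hv : (X : Fin 3 → CoordRing k) ⬝ᵥ v = 0) (h : ∀ l, l ≠ i → v l = 0) : v = 0 := by
  rw [dotProduct, Finset.sum_eq_single i (fun l _ hl => by rw [h l hl, mul_zero]) (by simp)] at hv
  funext l
  rcases eq_or_ne l i with rfl | hl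
  · exact (mul_eq_zero.mp hv).resolve_left (X_ne_zero l)
  · exact h l hl

variable [CharP k 2]

lemma toChart_eq_of_coverChartHom_rootFun_eq {i : Fin 3}
    {θ : CoverChart G' i →+* CoverChart G i} (hθ : θ.comp (chartIncl G' i) = chartIncl G i)
    {α β : ChartRing k i}
    (hαβ : θ (rootFun G' i) = chartIncl G i α + chartIncl G i β * rootFun G i) :
    toChart i (G' : CoordRing k) = α ^ 2 + β ^ 2 * toChart i (G : CoordRing k) := by
  refine chartIncl_injective G i ?_
  rw [← RingHom.congr_fun hθ, RingHom.comp_apply, ← rootFun_sq, map_pow, hαβ,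
    add_sq_of_charTwo_ringHom ((chartIncl G i).comp (toChart i)), mul_pow, rootFun_sq, map_add,
    map_mul, map_pow, map_pow]

lemma exists_toChart_eq_of_iso (e : Over.mk (coverProj G) ≅ Over.mk (coverProj G')) (i : Fin 3) :
    ∃ (b : k) (α : ChartRing k i), b ≠ 0 ∧
      toChart i (G' : CoordRing k) = α ^ 2 + toChart i (C b) ^ 2 * toChart i (G : CoordRing k) := by
  obtain ⟨θ, hθ⟩ := exists_coverChartHom (Over.w e.hom) i
  obtain ⟨θ', hθ'⟩ := exists_coverChartHom (Over.w e.inv) i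
  have hid : e.hom.left ≫ e.inv.left = 𝟙 (coverSurface G) :=
    congrArg CommaMorphism.left e.hom_inv_id
  obtain ⟨α, β, hαβ⟩ := exists_eq_chartIncl_add_mul_rootFun G i (θ (rootFun G' i))
  have hθι := coverChartHom_comp_chartIncl (Over.w e.hom) hθ
  obtain ⟨b, hb, rfl⟩ := exists_eq_toChart_C_of_isUnit
    (isUnit_of_coverChartHom_comp_eq_id hθι (coverChartHom_comp_eq_id hid hθ hθ') hαβ)
  exact ⟨b, α, hb, toChart_eq_of_coverChartHom_rootFun_eq hθι hαβ⟩

lemma chartDeriv_sq (i l : Fin 3) (α : ChartRing k i) : chartDeriv i l (α ^ 2) = 0 := by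
  have htwo : (2 : ChartRing k i) = 0 := by
    rw [← map_ofNat (toChart i), CharTwo.two_eq_zero, map_zero]
  rw [sq, Derivation.leibniz, ← two_mul, htwo, zero_mul]

lemma exists_gradient_eq_of_iso (e : Over.mk (coverProj G) ≅ Over.mk (coverProj G')) :
    ∃ c : k, c ≠ 0 ∧
      gradient (G' : CoordRing k) = (C c : CoordRing k) • gradient (G : CoordRing k) := by
  obtain ⟨b, α, hb, hα⟩ := exists_toChart_eq_of_iso e 0
  refine ⟨b ^ 2, pow_ne_zero 2 hb, sub_eq_zero.mp (eq_zero_of_X_dotProduct_eq_zero (i := 0) ?_ ?_)⟩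
  · rw [dotProduct_sub, dotProduct_smul, X_dotProduct_gradient_sextic,
      X_dotProduct_gradient_sextic, smul_zero, sub_zero]
  · intro l hl
    have hhom : gradient (G' : CoordRing k) l - C (b ^ 2) * gradient (G : CoordRing k) l ∈
        Form k 5 :=
      (gradient_isHomogeneous G'.2 l).sub ((gradient_isHomogeneous G.2 l).C_mul (b ^ 2))
    refine (toChart_eq_zero_iff (i := 0) hhom).mp ?_
    have hderiv := congrArg (chartDeriv (k := k) 0 l) hα
    rw [map_add, Derivation.leibniz, chartDeriv_sq, chartDeriv_sq, chartDeriv_toChart hl,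
      chartDeriv_toChart hl, smul_zero, add_zero, zero_add, smul_eq_mul] at hderiv
    rw [map_sub, hderiv, map_mul, C_pow, map_pow, sub_self]

end CoverIso

end PlaneDoubleCover

open PlaneDoubleCover MvPolynomial in
theorem proposition1p2_general {k : Type*} [Field k] [PerfectField k] [CharP k 2]
    (G G' : Form k 6) (hG : IsPrimitiveVector (gradient (G : CoordRing k))) :
    List.TFAE [
      Nonempty (Over.mk (coverProj G) ≅ Over.mk (coverProj G')),
      zeroSchemeD G = zeroSchemeD G',
      ∃ c : k, c ≠ 0 ∧ ∃ H : Form k 3,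
        (G' : CoordRing k) = C c * (G : CoordRing k) + (H : CoordRing k) ^ 2] := by
  simp only [exists_eq_C_mul_add_sq_iff]
  tfae_have 1 → 3 := fun ⟨e⟩ => exists_gradient_eq_of_iso e
  tfae_have 3 → 1 := fun ⟨c, hc, h⟩ =>
    (exists_eq_C_mul_add_sq_iff.mpr h).elim fun _ hH => nonempty_iso_of_eq_add_sq hc hH
  tfae_have 2 → 3 := exists_gradient_eq_of_zeroSchemeD_eq hG
  tfae_have 3 → 2 := fun ⟨_, hc, h⟩ => zeroSchemeD_eq_of_gradient_eq hc h
  tfae_finish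

open PlaneDoubleCover in
theorem proposition1p2 {k : Type*} [Field k] [IsAlgClosed k] [CharP k 2] (G G' : Form k 6)
    (hG : G ∈ nodalLocus k) (hG' : G' ∈ nodalLocus k) :
    List.TFAE [
      Nonempty (Over.mk (coverProj G) ≅ Over.mk (coverProj G')),
      zeroSchemeD G = zeroSchemeD G',
      ∃ c : k, c ≠ 0 ∧ ∃ H : Form k 3,
        (G' : MvPolynomial (Fin 3) k) = MvPolynomial.C c * (G : MvPolynomial (Fin 3) k) +
          (H : MvPolynomial (Fin 3) k) ^ 2] := by
  have hfin : (singularPoints (coverSurface G)).Finite :=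
    Set.finite_of_ncard_ne_zero (by rw [hG.2.1]; norm_num)
  exact proposition1p2_general G G' (isPrimitiveVector_gradient_of_finite_singularPoints hfin)
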